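/- **Setting.** For $\alpha_1,\dots,\alpha_n\ge 0$, not all zero, the Dirichlet distribution $\mathrm{Dir}_{(\alpha_1,\dots,\alpha_n)}$ is the law of $(G_1/S,\dots,G_n/S)$, where $S=G_1+\dots+G_n$ and the $G_j$ are independent, $G_j$ having the gamma law of shape $\alpha_j$ and rate $1$ (the point mass at $0$ if $\alpha_j=0$). For $c>0$ and a Borel probability measure $\rho$ on $\mathbb R$, a Dirichlet process $D_{c\rho}$ is a random probability measure on $\mathbb R$, defined on a probability space $(\Omega,\mathbb P)$, such that for every finite measurable partition $A_1,\dots,A_n$ of $\mathbb R$ the vector $(D_{c\rho}(A_1),\dots,D_{c\rho}(A_n))$ has law $\mathrm{Dir}_{(c\rho(A_1),\dots,c\rho(A_n))}$. Let $\rho^{(c)}$ be the law of the random mean $\int x\,D_{c\rho}(\mathrm dx)$. For $M>0$ let $$\rho^{[M]}=\rho((-\infty,-M])\,\delta_{-M}+\mathbf 1_{(-M,M)}\rho+\rho([M,\infty))\,\delta_M .$$ For $b\in\mathbb R$ and $0<\eta<2\pi$ let $\mathcal C_{b,\eta}$ be the Hankel loop that goes horizontally from $-\infty-i\eta$ to $b-i\eta$,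 then vertically to $b+i\eta$, then horizontally to $-\infty+i\eta$. All logarithms are principal. **Theorem (Mellin transform of $\rho^{(c)}$).** Let $c>0$, let $\rho$ be a Borel probability measure on $[0,\infty)$, regarded as a measure on $\mathbb R$, and let $u\in\mathbb C$ with $\operatorname{Re}u>0$ and $$\int_0^\infty x^{\operatorname{Re}u}\,\rho(\mathrm dx)<\infty .$$ Then $\int|x|\,D_{c\rho}(\mathrm dx)<\infty$ almost surely, the integral $\int x^u\,\rho^{(c)}(\mathrm dx)$ converges absolutely, and the following hold. 1. For any choice of $b_M>\log M$ and $0<\eta_M<2\pi$ ($M>0$), $$\int x^u\,\rho^{(c)}(\mathrm dx)=\lim_{M\to\infty}\frac{\Gamma(c)\Gamma(u+1)}{\Gamma(u+c)}\,\frac1{2\pi i}\int_{\mathcal C_{b_M,\eta_M}}\exp\Big(uz-c\int\log(1-se^{-z})\,\rho^{[M]}(\mathrm ds)\Big)\,\mathrm dz,$$ where for every $M>0$ the contour integral converges absolutely. 2. If $\rho$ is supported in $[0,R]$ for some $R>0$, then for all $b>\log R$ and $0<\eta<2\pi$, $$\int x^u\,\rho^{(c)}(\mathrm dx)=\frac{\Gamma(c)\Gamma(u+1)}{\Gamma(u+c)}\,\frac1{2\pi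 i}\int_{\mathcal C_{b,\eta}}\exp\Big(uz-c\int\log(1-se^{-z})\,\rho(\mathrm ds)\Big)\,\mathrm dz,$$ where the contour integral converges absolutely. -/

import Mathlib

open MeasureTheory ProbabilityTheory Filter Topology

noncomputable section

/-- The gamma law of shape `a ≥ 0` and rate `1`; for `a = 0` it is the point mass at `0`. -/
def gammaLaw (a : ℝ) : Measure ℝ :=
  if a = 0 then Measure.dirac 0 else gammaMeasure a 1

/-- The Dirichlet distribution with parameters `α i ≥ 0`, not all zero: the law of
`(G i / ∑ j, G j)` for independent gamma variables `G i` of shapes `α i`. Coordinates with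
parameter `0` vanish almost surely; on the others it is the law on the simplex with density
proportional to `∏ i, σ i ^ (α i - 1)`. -/
def dirichletLaw {n : ℕ} (α : Fin n → ℝ) : Measure (Fin n → ℝ) :=
  (Measure.pi fun i => gammaLaw (α i)).map fun g i => g i / ∑ j, g j

/-- The random probability measure `D` (a measurable map from `Ω` to the probability measures
on `ℝ`, that is, a Markov kernel) is a Dirichlet process with parameter measure `α`: on every
finite measurable partition of `ℝ` its values follow the Dirichlet distribution. -/
def IsDirichletProcess {Ω : Type*} [MeasurableSpace Ω] (P : Measure Ω) (D : Kernel Ω ℝ)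
    [IsMarkovKernel D] (α : Measure ℝ) : Prop :=
  ∀ (n : ℕ) (A : Fin n → Set ℝ), (∀ i, MeasurableSet (A i)) →
    (∀ i j, i ≠ j → Disjoint (A i) (A j)) → (⋃ i, A i) = Set.univ →
    P.map (fun ω i => (D ω).real (A i)) = dirichletLaw fun i => α.real (A i)

/-- The law of the random mean `ω ↦ ∫ x, x ∂(D ω)`. -/
def randomMeanLaw {Ω : Type*} [MeasurableSpace Ω] (P : Measure Ω) (D : Kernel Ω ℝ) : Measure ℝ :=
  P.map fun ω => ∫ x, x ∂(D ω)

/-- The truncation of `ρ` at level `M`: the mass outside `(-M, M)` is moved to `-M` and `M`. -/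
def truncatedMeasure (ρ : Measure ℝ) (M : ℝ) : Measure ℝ :=
  ρ (Set.Iic (-M)) • Measure.dirac (-M) + ρ.restrict (Set.Ioo (-M) M)
    + ρ (Set.Ici M) • Measure.dirac M

/-- `exp (u z - c ∫ log (1 - s e^{-z}) dρ(s))`, with the principal branch of the logarithm. -/
def mellinIntegrand (ρ : Measure ℝ) (c : ℝ) (u z : ℂ) : ℂ :=
  Complex.exp (u * z - c * ∫ s : ℝ, Complex.log (1 - s * Complex.exp (-z)) ∂ρ)

/-- Absolute convergence of the integral of `f` along the Hankel loop
`-∞ - iη → b - iη → b + iη → -∞ + iη`. -/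
def HankelIntegrable (f : ℂ → ℂ) (b η : ℝ) : Prop :=
  IntegrableOn (fun t : ℝ => f (t - η * Complex.I)) (Set.Iic b) ∧
  IntervalIntegrable (fun y : ℝ => f (b + y * Complex.I)) volume (-η) η ∧
  IntegrableOn (fun t : ℝ => f (t + η * Complex.I)) (Set.Iic b)

/-- The integral `∫ f(z) dz` along the Hankel loop that goes horizontally from `-∞ - iη` to
`b - iη`, then vertically to `b + iη`, then horizontally to `-∞ + iη`. -/
def hankelIntegral (f : ℂ → ℂ) (b η : ℝ) : ℂ :=
  (∫ t in Set.Iic b, f (t - η * Complex.I))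
    + Complex.I * (∫ y in (-η)..η, f (b + y * Complex.I))
    - ∫ t in Set.Iic b, f (t + η * Complex.I)

/-- `Γ(c) Γ(u+1) / Γ(u+c) · (2πi)⁻¹ ∫ exp (u z - c ∫ log (1 - s e^{-z}) dρ(s)) dz`
along the Hankel loop with parameters `b` and `η`. -/
def mellinContour (ρ : Measure ℝ) (c : ℝ) (u : ℂ) (b η : ℝ) : ℂ :=
  Complex.Gamma c * Complex.Gamma (u + 1) / Complex.Gamma (u + c)
    * ((2 * Real.pi * Complex.I)⁻¹ * hankelIntegral (mellinIntegrand ρ c u) b η)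

end

/-! ### Exponential tilting of gamma and Dirichlet laws -/

instance isProbabilityMeasure_gammaLaw {a : ℝ} [Fact (0 ≤ a)] :
    IsProbabilityMeasure (gammaLaw a) := by
  unfold gammaLaw
  split_ifs with h
  · infer_instance
  · exact isProbabilityMeasure_gammaMeasure (lt_of_le_of_ne (Fact.out : 0 ≤ a) (Ne.symm h)) one_pos

theorem lintegral_gammaMeasure_tilt {a r : ℝ} (hr : 0 < r) {F : ℝ → ENNReal}
    (hF : Measurable F) :
    ∫⁻ x, ENNReal.ofReal (Real.exp ((1 - r) * x)) * F x ∂(gammaMeasure a 1)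
      = ENNReal.ofReal (r ^ (-a)) * ∫⁻ x, F (x / r) ∂(gammaMeasure a 1) := by
  have hm : Measurable (gammaPDF a 1) := (measurable_gammaPDFReal a 1).ennreal_ofReal
  unfold gammaMeasure
  rw [lintegral_withDensity_eq_lintegral_mul _ hm (by fun_prop),
    lintegral_withDensity_eq_lintegral_mul _ hm (by fun_prop)]
  conv_rhs => rw [← Real.smul_map_volume_mul_left hr.ne']
  rw [lintegral_smul_measure, lintegral_map (by fun_prop) (by fun_prop), abs_of_pos hr, smul_eq_mul,
    ← mul_assoc, ← ENNReal.ofReal_mul (by positivity), ← lintegral_const_mul _ (by fun_prop)]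
  refine lintegral_congr fun x => ?_
  simp only [Pi.mul_apply]
  rw [mul_div_cancel_left₀ _ hr.ne', ← mul_assoc, ← mul_assoc]
  congr 1
  rcases lt_or_ge x 0 with hx | hx
  · rw [gammaPDF_of_neg hx, gammaPDF_of_neg (mul_neg_of_pos_of_neg hr hx)]; simp
  · rw [gammaPDF_of_nonneg hx, gammaPDF_of_nonneg (mul_nonneg hr.le hx),
      ← ENNReal.ofReal_mul' (by positivity), ← ENNReal.ofReal_mul (by positivity)]
    congr 1
    rw [Real.mul_rpow hr.le hx, Real.rpow_sub_one hr.ne', Real.rpow_neg hr.le]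
    have : Real.exp (-(1 * (r * x))) = Real.exp (-(1 * x)) * Real.exp ((1 - r) * x) := by
      rw [← Real.exp_add]; ring_nf
    rw [this]
    have := (Real.rpow_pos_of_pos hr a).ne'
    field_simp

theorem lintegral_gammaLaw_tilt {a r : ℝ} (hr : 0 < r) {F : ℝ → ENNReal} (hF : Measurable F) :
    ∫⁻ x, ENNReal.ofReal (Real.exp ((1 - r) * x)) * F x ∂(gammaLaw a)
      = ENNReal.ofReal (r ^ (-a)) * ∫⁻ x, F (x / r) ∂(gammaLaw a) := by
  unfold gammaLaw
  split_ifs with h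
  · rw [lintegral_dirac' _ (by fun_prop), lintegral_dirac' _ (by fun_prop)]; simp [h]
  · exact lintegral_gammaMeasure_tilt hr hF

theorem gammaLaw_Iio {a : ℝ} : gammaLaw a (Set.Iio 0) = 0 := by
  unfold gammaLaw
  split_ifs with h
  · simp
  · rw [gammaMeasure, withDensity_apply _ measurableSet_Iio]
    exact lintegral_gammaPDF_of_nonpos le_rfl

theorem gammaLaw_Iic {a : ℝ} (ha : a ≠ 0) : gammaLaw a (Set.Iic 0) = 0 := by
  unfold gammaLaw
  rw [if_neg ha, gammaMeasure, withDensity_apply _ measurableSet_Iic,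
    ← setLIntegral_congr Iio_ae_eq_Iic]
  exact lintegral_gammaPDF_of_nonpos le_rfl

theorem lintegral_pi_prod {n : ℕ} (μ : Fin n → Measure ℝ) [∀ i, IsProbabilityMeasure (μ i)]
    {f : Fin n → ℝ → ENNReal} (hf : ∀ i, Measurable (f i)) :
    ∫⁻ g, ∏ i, f i (g i) ∂(Measure.pi μ) = ∏ i, ∫⁻ x, f i x ∂(μ i) := by
  rw [lintegral_prod_eq_prod_lintegral_of_indepFun Finset.univ (fun i (g : Fin n → ℝ) => f i (g i))
    (iIndepFun_pi fun i => (hf i).aemeasurable) (fun i => (hf i).comp (measurable_pi_apply i))]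
  exact Finset.prod_congr rfl fun i _ => (measurePreserving_eval μ i).lintegral_comp (hf i)

section Pi

variable {n : ℕ} {α : Fin n → ℝ}

theorem withDensity_exp_pi_gammaLaw [∀ i, Fact (0 ≤ α i)] {r : Fin n → ℝ} (hr : ∀ i, 0 < r i) :
    (Measure.pi fun i => gammaLaw (α i)).withDensity
        (fun g => ∏ i, ENNReal.ofReal (Real.exp ((1 - r i) * g i)))
      = (∏ i, ENNReal.ofReal (r i ^ (-α i))) •
        (Measure.pi fun i => gammaLaw (α i)).map fun g i => g i / r i := by
  have key : ∀ i, ∀ s : Set ℝ, MeasurableSet s →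
      ∫⁻ x, ENNReal.ofReal (Real.exp ((1 - r i) * x)) * s.indicator 1 x ∂gammaLaw (α i)
        = ENNReal.ofReal (r i ^ (-α i)) * (gammaLaw (α i)).map (fun x => x / r i) s := by
    intro i s hs
    rw [lintegral_gammaLaw_tilt (hr i) (measurable_one.indicator hs),
      Measure.map_apply (by fun_prop) hs]
    congr 1
    rw [← lintegral_indicator_one ((by fun_prop : Measurable fun x : ℝ => x / r i) hs)]
    rfl
  have hfin : ∀ i, IsProbabilityMeasure ((gammaLaw (α i)).map fun x => x / r i) :=
    fun i => Measure.isProbabilityMeasure_map (by fun_prop)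
  rw [Measure.pi_map_pi (μ := fun i => gammaLaw (α i)) (f := fun i x => x / r i)
    (fun i => by fun_prop)]
  have h2 : (∏ i, ENNReal.ofReal (r i ^ (-α i))) •
      (Measure.pi fun i => (gammaLaw (α i)).map fun x => x / r i)
      = Measure.pi fun i => ENNReal.ofReal (r i ^ (-α i)) •
          (gammaLaw (α i)).map fun x => x / r i := by
    have hf : ∀ i, IsFiniteMeasure (ENNReal.ofReal (r i ^ (-α i)) •
          (gammaLaw (α i)).map fun x => x / r i) :=
      fun i => Measure.smul_finite _ ENNReal.ofReal_ne_top
    symm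
    refine Measure.pi_eq fun s hs => ?_
    simp only [Measure.smul_apply, Measure.pi_pi, smul_eq_mul, Finset.prod_mul_distrib]
  rw [h2]
  have hf : ∀ i, IsFiniteMeasure (ENNReal.ofReal (r i ^ (-α i)) •
          (gammaLaw (α i)).map fun x => x / r i) :=
      fun i => Measure.smul_finite _ ENNReal.ofReal_ne_top
  symm
  refine Measure.pi_eq fun s hs => ?_
  rw [withDensity_apply _ (MeasurableSet.univ_pi hs),
    ← lintegral_indicator (MeasurableSet.univ_pi hs)]
  have : ∀ g : Fin n → ℝ, (Set.univ.pi s).indicator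
      (fun g => ∏ i, ENNReal.ofReal (Real.exp ((1 - r i) * g i))) g
      = ∏ i, (ENNReal.ofReal (Real.exp ((1 - r i) * g i)) * (s i).indicator 1 (g i)) := by
    intro g
    by_cases hg : g ∈ Set.univ.pi s
    · rw [Set.indicator_of_mem hg]
      refine Finset.prod_congr rfl fun i _ => ?_
      rw [Set.indicator_of_mem (hg i (Set.mem_univ i))]; simp
    · rw [Set.indicator_of_notMem hg]
      simp only [Set.mem_univ_pi, not_forall] at hg
      obtain ⟨i, hi⟩ := hg
      rw [eq_comm, Finset.prod_eq_zero (Finset.mem_univ i)]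
      rw [Set.indicator_of_notMem hi, mul_zero]
  simp_rw [this]
  have hmeas : ∀ i, Measurable fun x : ℝ =>
      ENNReal.ofReal (Real.exp ((1 - r i) * x)) * (s i).indicator 1 x :=
    fun i => Measurable.mul (by fun_prop) (measurable_one.indicator (hs i))
  rw [lintegral_pi_prod _ hmeas]
  exact Finset.prod_congr rfl fun i _ => by rw [Measure.smul_apply, smul_eq_mul, ← key i _ (hs i)]

theorem lintegral_pi_gammaLaw_tilt [∀ i, Fact (0 ≤ α i)] {r : Fin n → ℝ} (hr : ∀ i, 0 < r i)
    {F : (Fin n → ℝ) → ENNReal} (hF : Measurable F) :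
    ∫⁻ g, ENNReal.ofReal (Real.exp (∑ i, (1 - r i) * g i)) * F g
        ∂(Measure.pi fun i => gammaLaw (α i))
      = ENNReal.ofReal (∏ i, r i ^ (-α i)) *
        ∫⁻ g, F (fun i => g i / r i) ∂(Measure.pi fun i => gammaLaw (α i)) := by
  have h := congrArg (fun μ => ∫⁻ g, F g ∂μ) (withDensity_exp_pi_gammaLaw (α := α) hr)
  beta_reduce at h
  rw [lintegral_withDensity_eq_lintegral_mul _ (by fun_prop) hF, lintegral_smul_measure,
    lintegral_map hF (by fun_prop)] at h
  rw [ENNReal.ofReal_prod_of_nonneg (fun i _ => Real.rpow_nonneg (hr i).le _)]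
  rw [smul_eq_mul] at h
  rw [← h]
  refine lintegral_congr fun g => ?_
  rw [Real.exp_sum, ENNReal.ofReal_prod_of_nonneg (fun i _ => (Real.exp_pos _).le)]
  rfl

end Pi

theorem lintegral_rpow_mul_exp_neg {c N : ℝ} (hc : 0 < c) (hN : 0 < N) :
    ∫⁻ t in Set.Ioi (0 : ℝ), ENNReal.ofReal (t ^ (c - 1) * Real.exp (-(N * t)))
      = ENNReal.ofReal (Real.Gamma c * N ^ (-c)) := by
  rw [← ofReal_integral_eq_lintegral_ofReal]
  · rw [Real.integral_rpow_mul_exp_neg_mul_Ioi hc hN, one_div, Real.inv_rpow hN.le,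
      Real.rpow_neg hN.le, mul_comm]
  · have := integrableOn_rpow_mul_exp_neg_mul_rpow (p := 1) (s := c - 1) (by linarith) one_pos hN
    simpa [IntegrableOn] using this
  · filter_upwards [ae_restrict_mem measurableSet_Ioi] with t ht
    have : (0 : ℝ) < t := ht
    positivity

theorem lintegral_Ioi_comp_inv (φ : ℝ → ENNReal) :
    ∫⁻ t in Set.Ioi (0 : ℝ), φ t
      = ∫⁻ r in Set.Ioi (0 : ℝ), ENNReal.ofReal (r ^ (-2 : ℝ)) * φ r⁻¹ := by
  have himg : (fun x : ℝ => x⁻¹) '' Set.Ioi 0 = Set.Ioi 0 := by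
    rw [Set.image_inv_eq_inv]; ext x; simp
  conv_lhs => rw [← himg]
  rw [lintegral_image_eq_lintegral_abs_deriv_mul measurableSet_Ioi
    (fun x hx => (hasDerivAt_inv (ne_of_gt hx)).hasDerivWithinAt) inv_injective.injOn]
  refine setLIntegral_congr_fun measurableSet_Ioi fun x hx => ?_
  have hx : (0 : ℝ) < x := hx
  rw [abs_neg, abs_of_pos (by positivity), Real.rpow_neg hx.le, Real.rpow_two]

theorem lintegral_rpow_mul_exp_neg_div {c N : ℝ} (hc : 0 < c) (hN : 0 < N) :
    ∫⁻ r in Set.Ioi (0 : ℝ), ENNReal.ofReal (r ^ (-1 - c) * Real.exp (-(N / r)))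
      = ENNReal.ofReal (Real.Gamma c * N ^ (-c)) := by
  rw [← lintegral_rpow_mul_exp_neg hc hN,
    lintegral_Ioi_comp_inv fun t => ENNReal.ofReal (t ^ (c - 1) * Real.exp (-(N * t)))]
  refine setLIntegral_congr_fun measurableSet_Ioi fun x hx => ?_
  have hx : (0 : ℝ) < x := hx
  rw [← ENNReal.ofReal_mul (by positivity), Real.inv_rpow hx.le, ← Real.rpow_neg hx.le, ← mul_assoc,
    ← Real.rpow_add hx]
  ring_nf

/-- The Laplace-type transform that characterises the Dirichlet law. -/
theorem lintegral_rpow_neg_dirichletLaw {n : ℕ} {α : Fin n → ℝ} (hα : ∀ i, 0 ≤ α i)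
    {c : ℝ} (hc : 0 < c) (hsum : ∑ i, α i = c) {l : Fin n → ℝ} (hl : ∀ i, 0 < l i) :
    ∫⁻ x, ENNReal.ofReal ((∑ i, l i * x i) ^ (-c)) ∂(dirichletLaw α)
      = ENNReal.ofReal (∏ i, l i ^ (-α i)) := by
  have : ∀ i, Fact (0 ≤ α i) := fun i => ⟨hα i⟩
  set π := Measure.pi fun i => gammaLaw (α i) with hπ
  rw [dirichletLaw, ← hπ, lintegral_map (by fun_prop) (by fun_prop)]
  have hnn : ∀ᵐ g ∂π, ∀ i, 0 ≤ g i := by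
    rw [ae_all_iff]
    intro i
    refine (measurePreserving_eval (fun i => gammaLaw (α i)) i).quasiMeasurePreserving.ae
      (p := fun x => 0 ≤ x) ?_
    rw [ae_iff]
    simpa [Set.Iio_def] using gammaLaw_Iio (a := α i)
  obtain ⟨k, hk⟩ : ∃ k, α k ≠ 0 := by
    by_contra! h
    simp [h] at hsum; linarith
  have hpos : ∀ᵐ g ∂π, 0 < g k := by
    refine (measurePreserving_eval (fun i => gammaLaw (α i)) k).quasiMeasurePreserving.ae
      (p := fun x => 0 < x) ?_
    rw [ae_iff]
    simpa [Set.Iic_def] using gammaLaw_Iic hk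
  have hS : ∀ᵐ g ∂π, 0 < ∑ i, g i ∧ 0 < ∑ i, l i * g i := by
    filter_upwards [hnn, hpos] with g h1 h2
    exact ⟨Finset.sum_pos' (fun i _ => h1 i) ⟨k, Finset.mem_univ k, h2⟩,
      Finset.sum_pos' (fun i _ => mul_nonneg (hl i).le (h1 i))
        ⟨k, Finset.mem_univ k, mul_pos (hl k) h2⟩⟩
  have hΓ : ENNReal.ofReal (Real.Gamma c) ≠ 0 := by simpa using Real.Gamma_pos_of_pos hc
  have hΓ0 := Real.Gamma_pos_of_pos hc
  rw [← ENNReal.mul_right_inj hΓ ENNReal.ofReal_ne_top]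
  -- both sides as double integrals
  have hL : ENNReal.ofReal (Real.Gamma c) *
      ∫⁻ g, ENNReal.ofReal ((∑ i, l i * (g i / ∑ j, g j)) ^ (-c)) ∂π
      = ∫⁻ r in Set.Ioi (0 : ℝ), ∫⁻ g, ENNReal.ofReal (r ^ (-1 - c) *
          ((∑ i, g i) ^ c * Real.exp (-((∑ i, l i * g i) / r)))) ∂π := by
    rw [← lintegral_const_mul _ (by fun_prop), lintegral_lintegral_swap (by fun_prop)]
    refine lintegral_congr_ae ?_
    filter_upwards [hS] with g hg
    have : ∀ r, ENNReal.ofReal (r ^ (-1 - c) *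
          ((∑ i, g i) ^ c * Real.exp (-((∑ i, l i * g i) / r))))
        = ENNReal.ofReal ((∑ i, g i) ^ c) * ENNReal.ofReal (r ^ (-1 - c) *
          Real.exp (-((∑ i, l i * g i) / r))) := by
      intro r
      rw [← ENNReal.ofReal_mul (Real.rpow_nonneg hg.1.le _)]
      ring_nf
    simp_rw [this]
    rw [lintegral_const_mul _ (by fun_prop), lintegral_rpow_mul_exp_neg_div hc hg.2,
      ← ENNReal.ofReal_mul hΓ0.le, ← ENNReal.ofReal_mul (Real.rpow_nonneg hg.1.le _)]
    congr 1
    simp_rw [← mul_div_assoc]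
    rw [← Finset.sum_div, Real.div_rpow hg.2.le hg.1.le, Real.rpow_neg hg.1.le]
    have := (Real.rpow_pos_of_pos hg.1 c).ne'
    field_simp
  have hR : ENNReal.ofReal (Real.Gamma c) * ∫⁻ g, ENNReal.ofReal (Real.exp (∑ i, (1 - l i) * g i)) ∂π
      = ∫⁻ r in Set.Ioi (0 : ℝ), ENNReal.ofReal (r ^ (c - 1)) *
        ∫⁻ g, ENNReal.ofReal (Real.exp (∑ i, (1 - r) * g i)) *
          ENNReal.ofReal ((∑ i, g i) ^ c * Real.exp (-(∑ i, l i * g i))) ∂π := by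
    have : ∀ r : ℝ, ENNReal.ofReal (r ^ (c - 1)) *
        ∫⁻ g, ENNReal.ofReal (Real.exp (∑ i, (1 - r) * g i)) *
          ENNReal.ofReal ((∑ i, g i) ^ c * Real.exp (-(∑ i, l i * g i))) ∂π
        = ∫⁻ g, ENNReal.ofReal (r ^ (c - 1)) *
          (ENNReal.ofReal (Real.exp (∑ i, (1 - r) * g i)) *
          ENNReal.ofReal ((∑ i, g i) ^ c * Real.exp (-(∑ i, l i * g i)))) ∂π := by
      intro r
      rw [lintegral_const_mul _ (by fun_prop)]
    simp_rw [this]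
    rw [← lintegral_const_mul _ (by fun_prop), lintegral_lintegral_swap (by fun_prop)]
    refine lintegral_congr_ae ?_
    filter_upwards [hS] with g hg
    have : ∀ r ∈ Set.Ioi (0 : ℝ), ENNReal.ofReal (r ^ (c - 1)) *
          (ENNReal.ofReal (Real.exp (∑ i, (1 - r) * g i)) *
          ENNReal.ofReal ((∑ i, g i) ^ c * Real.exp (-(∑ i, l i * g i))))
        = ENNReal.ofReal ((∑ i, g i) ^ c * Real.exp (∑ i, (1 - l i) * g i)) *
          ENNReal.ofReal (r ^ (c - 1) * Real.exp (-((∑ i, g i) * r))) := by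
      intro r hr
      have hr : 0 < r := hr
      have h1 := hg.1
      rw [← ENNReal.ofReal_mul (by positivity), ← ENNReal.ofReal_mul (by positivity),
        ← ENNReal.ofReal_mul (by positivity)]
      congr 1
      simp_rw [sub_mul, one_mul, Finset.sum_sub_distrib, ← Finset.mul_sum, sub_eq_add_neg,
        Real.exp_add]
      ring_nf
    rw [setLIntegral_congr_fun measurableSet_Ioi this, lintegral_const_mul _ (by fun_prop),
      lintegral_rpow_mul_exp_neg hc hg.1, ← ENNReal.ofReal_mul hΓ0.le,
      ← ENNReal.ofReal_mul (by have := hg.1; positivity)]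
    congr 1
    rw [Real.rpow_neg hg.1.le]
    have := (Real.rpow_pos_of_pos hg.1 c).ne'
    field_simp
  have hE : ∫⁻ g, ENNReal.ofReal (Real.exp (∑ i, (1 - l i) * g i)) ∂π
      = ENNReal.ofReal (∏ i, l i ^ (-α i)) := by
    simpa using lintegral_pi_gammaLaw_tilt (α := α) hl (F := fun _ => 1) measurable_const
  rw [hL, ← hE, hR]
  refine setLIntegral_congr_fun measurableSet_Ioi fun r hr => ?_
  have hr : (0 : ℝ) < r := hr
  rw [lintegral_pi_gammaLaw_tilt (α := α) (r := fun _ => r) (fun _ => hr) (by fun_prop),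
    ← mul_assoc, ← ENNReal.ofReal_mul (by positivity), ← lintegral_const_mul _ (by fun_prop)]
  refine lintegral_congr_ae ?_
  filter_upwards [hS] with g hg
  rw [← ENNReal.ofReal_mul (mul_nonneg (by positivity)
    (Finset.prod_nonneg fun i _ => by positivity))]
  congr 1
  have h1 : ∏ i, r ^ (-α i) = r ^ (-c) := by
    rw [← hsum, ← Finset.sum_neg_distrib, Real.rpow_sum_of_pos hr]
  simp_rw [← mul_div_assoc]
  rw [h1, ← Finset.sum_div, ← Finset.sum_div, Real.div_rpow hg.1.le hr.le, div_eq_mul_inv _ (r ^ c),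
    ← Real.rpow_neg hr.le, show -1 - c = (c - 1) + -c + -c by ring, Real.rpow_add hr,
    Real.rpow_add hr]
  ring

/-! ### The Markov–Krein identity and moments of random means -/

theorem integrable_of_mem_Icc {X : Type*} [MeasurableSpace X] {μ : Measure X} [IsFiniteMeasure μ]
    {f : X → ℝ} (hf : Measurable f) {R : ℝ} (h : ∀ x, f x ∈ Set.Icc 0 R) : Integrable f μ :=
  Integrable.of_bound hf.aestronglyMeasurable R
    (ae_of_all _ fun x => by rw [Real.norm_of_nonneg (h x).1]; exact (h x).2)

theorem rpow_neg_mem_Icc {c y : ℝ} (hc : 0 < c) (hy : 0 ≤ y) :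
    (1 + y) ^ (-c) ∈ Set.Icc (0 : ℝ) 1 :=
  ⟨by positivity, Real.rpow_le_one_of_one_le_of_nonpos (by linarith) (by linarith)⟩

section

variable {Ω : Type*} [MeasurableSpace Ω] {P : Measure Ω}
  {ρ : Measure ℝ} [IsProbabilityMeasure ρ] {c : ℝ} {D : Kernel Ω ℝ} [IsMarkovKernel D]

theorem integral_comp_fin {n : ℕ} {μ : Measure ℝ} [IsFiniteMeasure μ] {κ : ℝ → Fin n}
    (hκ : Measurable κ) (a : Fin n → ℝ) :
    ∫ x, a (κ x) ∂μ = ∑ i, a i * μ.real (κ ⁻¹' {i}) := by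
  have h : ∫ x, a (κ x) ∂μ = ∫ i, a i ∂(μ.map κ) :=
    (integral_map hκ.aemeasurable (measurable_of_finite a).aestronglyMeasurable).symm
  rw [h, integral_fintype Integrable.of_finite]
  refine Finset.sum_congr rfl fun i _ => ?_
  rw [map_measureReal_apply hκ (measurableSet_singleton i), smul_eq_mul, mul_comm]

theorem markovKrein_fin (hc : 0 < c) (hD : IsDirichletProcess P D (ENNReal.ofReal c • ρ))
    {n : ℕ} {κ : ℝ → Fin n} (hκ : Measurable κ) {a : Fin n → ℝ} (ha : ∀ i, 0 ≤ a i)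
    {t : ℝ} (ht : 0 ≤ t) :
    ∫ ω, (1 + t * ∫ x, a (κ x) ∂(D ω)) ^ (-c) ∂P
      = Real.exp (-c * ∫ x, Real.log (1 + t * a (κ x)) ∂ρ) := by
  have hA : ∀ i, MeasurableSet (κ ⁻¹' {i}) := fun i => hκ (measurableSet_singleton i)
  have hlaw := hD n (fun i => κ ⁻¹' {i}) hA
    (fun i j hij => Disjoint.preimage _ (by simpa using hij)) (by ext x; simp)
  have hl : ∀ i, 0 < 1 + t * a i := fun i => by have := mul_nonneg ht (ha i); linarith
  have hsum1 : ∀ (μ : Measure ℝ) [IsProbabilityMeasure μ], ∑ i, μ.real (κ ⁻¹' {i}) = 1 := by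
    intro μ _
    simpa using (integral_comp_fin (μ := μ) hκ fun _ => 1).symm
  have hrho : ∀ i, (ENNReal.ofReal c • ρ).real (κ ⁻¹' {i}) = c * ρ.real (κ ⁻¹' {i}) := fun i => by
    rw [measureReal_ennreal_smul_apply, ENNReal.toReal_ofReal hc.le]
  have key := lintegral_rpow_neg_dirichletLaw (n := n)
    (α := fun i => (ENNReal.ofReal c • ρ).real (κ ⁻¹' {i}))
    (fun i => measureReal_nonneg) hc
    (by simp_rw [hrho]; rw [← Finset.mul_sum, hsum1, mul_one]) hl
  have hmeas : Measurable fun ω => fun i => (D ω).real (κ ⁻¹' {i}) :=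
    measurable_pi_lambda _ fun i => (D.measurable_coe (hA i)).ennreal_toReal
  rw [← hlaw, lintegral_map (by fun_prop) hmeas] at key
  have hlin : ∀ ω, ∑ i, (1 + t * a i) * (D ω).real (κ ⁻¹' {i}) = 1 + t * ∫ x, a (κ x) ∂(D ω) := by
    intro ω
    rw [integral_comp_fin hκ]
    simp_rw [add_mul, one_mul, Finset.sum_add_distrib, hsum1, Finset.mul_sum, mul_assoc]
  simp_rw [hlin] at key
  have hnn : ∀ ω, 0 ≤ t * ∫ x, a (κ x) ∂(D ω) := fun ω =>
    mul_nonneg ht (integral_nonneg fun x => ha _)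
  have hm2 : Measurable fun ω => (1 + t * ∫ x, a (κ x) ∂(D ω)) ^ (-c) := by
    have := (StronglyMeasurable.integral_kernel (κ := D)
      ((measurable_of_finite a).comp hκ).stronglyMeasurable).measurable
    simp only [Function.comp_apply] at this
    fun_prop
  rw [integral_eq_lintegral_of_nonneg_ae
    (ae_of_all _ fun ω => (rpow_neg_mem_Icc hc (hnn ω)).1) hm2.aestronglyMeasurable, key,
    ENNReal.toReal_ofReal (Finset.prod_nonneg fun i _ => (Real.rpow_pos_of_pos (hl i) _).le),
    integral_comp_fin hκ fun i => Real.log (1 + t * a i), Finset.mul_sum, Real.exp_sum]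
  refine Finset.prod_congr rfl fun i _ => ?_
  rw [hrho, Real.rpow_def_of_pos (hl i)]
  ring_nf

variable [IsProbabilityMeasure P]

theorem markovKrein_bounded (hc : 0 < c) (hD : IsDirichletProcess P D (ENNReal.ofReal c • ρ))
    {f : ℝ → ℝ} (hf : Measurable f) {R : ℝ} (hfR : ∀ x, f x ∈ Set.Icc 0 R)
    {t : ℝ} (ht : 0 ≤ t) :
    ∫ ω, (1 + t * ∫ x, f x ∂(D ω)) ^ (-c) ∂P
      = Real.exp (-c * ∫ x, Real.log (1 + t * f x) ∂ρ) := by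
  set g : ℕ → ℝ → ℝ := fun k x => (⌊f x * (k : ℝ)⌋₊ : ℝ) / (k : ℝ) with hg
  have hg0 : ∀ k x, 0 ≤ g k x := fun k x => by positivity
  have hgf : ∀ k x, g k x ≤ f x := by
    intro k x
    rcases Nat.eq_zero_or_pos k with rfl | hk
    · simpa [hg] using (hfR x).1
    · rw [hg]
      have hk' : (0 : ℝ) < k := by exact_mod_cast hk
      rw [div_le_iff₀ hk']
      exact Nat.floor_le (mul_nonneg (hfR x).1 hk'.le)
  have hgm : ∀ k, Measurable (g k) := fun k => by fun_prop
  have hlim : ∀ x, Tendsto (fun k => g k x) atTop (𝓝 (f x)) := fun x =>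
    (tendsto_nat_floor_mul_div_atTop (hfR x).1).comp tendsto_natCast_atTop_atTop
  have hid : ∀ k, ∫ ω, (1 + t * ∫ x, g k x ∂(D ω)) ^ (-c) ∂P
      = Real.exp (-c * ∫ x, Real.log (1 + t * g k x) ∂ρ) := by
    intro k
    have hlt : ∀ x, ⌊f x * (k : ℝ)⌋₊ < ⌊R * (k : ℝ)⌋₊ + 1 := fun x =>
      Nat.lt_succ_of_le (Nat.floor_mono (mul_le_mul_of_nonneg_right (hfR x).2 (Nat.cast_nonneg k)))
    exact markovKrein_fin hc hD (n := ⌊R * (k : ℝ)⌋₊ + 1)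
      (κ := fun x => ⟨⌊f x * (k : ℝ)⌋₊, hlt x⟩)
      (by
        have h : Measurable fun x => ⌊f x * (k : ℝ)⌋₊ := by fun_prop
        refine measurable_to_countable' fun i => ?_
        convert h (measurableSet_singleton (i : ℕ)) using 1
        ext x; simp [Fin.ext_iff])
      (a := fun i => (i : ℝ) / (k : ℝ)) (fun i => by positivity) ht
  have hDlim : ∀ ω, Tendsto (fun k => ∫ x, g k x ∂(D ω)) atTop (𝓝 (∫ x, f x ∂(D ω))) := fun ω =>
    tendsto_integral_of_dominated_convergence (fun _ => R)
      (fun k => (hgm k).aestronglyMeasurable) (integrable_const _)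
      (fun k => ae_of_all _ fun x => by
        rw [Real.norm_of_nonneg (hg0 k x)]; exact (hgf k x).trans (hfR x).2)
      (ae_of_all _ hlim)
  have hL : Tendsto (fun k => ∫ ω, (1 + t * ∫ x, g k x ∂(D ω)) ^ (-c) ∂P) atTop
      (𝓝 (∫ ω, (1 + t * ∫ x, f x ∂(D ω)) ^ (-c) ∂P)) := by
    refine tendsto_integral_of_dominated_convergence (fun _ => 1) (fun k => ?_)
      (integrable_const _) (fun k => ae_of_all _ fun ω => ?_) (ae_of_all _ fun ω => ?_)
    · have := (StronglyMeasurable.integral_kernel (κ := D) (hgm k).stronglyMeasurable).measurable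
      exact Measurable.aestronglyMeasurable (by fun_prop)
    · have := rpow_neg_mem_Icc hc (mul_nonneg ht (integral_nonneg (μ := D ω) (hg0 k)))
      rw [Real.norm_of_nonneg this.1]; exact this.2
    · have : 0 ≤ t * ∫ x, f x ∂(D ω) := mul_nonneg ht (integral_nonneg fun x => (hfR x).1)
      exact (((hDlim ω).const_mul t).const_add 1).rpow_const (Or.inl (by linarith))
  have hRlim : Tendsto (fun k => ∫ x, Real.log (1 + t * g k x) ∂ρ) atTop
      (𝓝 (∫ x, Real.log (1 + t * f x) ∂ρ)) := by
    refine tendsto_integral_of_dominated_convergence (fun _ => Real.log (1 + t * R))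
      (fun k => Measurable.aestronglyMeasurable (by fun_prop)) (integrable_const _)
      (fun k => ae_of_all _ fun x => ?_) (ae_of_all _ fun x => ?_)
    · have h1 : 0 ≤ t * g k x := mul_nonneg ht (hg0 k x)
      rw [Real.norm_of_nonneg (Real.log_nonneg (by linarith))]
      have := mul_le_mul_of_nonneg_left ((hgf k x).trans (hfR x).2) ht
      exact Real.log_le_log (by linarith) (by linarith)
    · have : 0 ≤ t * f x := mul_nonneg ht (hfR x).1
      exact (((hlim x).const_mul t).const_add 1).log (by linarith)
  simp_rw [hid] at hL
  exact tendsto_nhds_unique hL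
    ((Real.continuous_exp.tendsto _).comp (hRlim.const_mul (-c)))

theorem one_sub_markovKrein_le (hc : 0 < c)
    (hD : IsDirichletProcess P D (ENNReal.ofReal c • ρ))
    {f : ℝ → ℝ} (hf : Measurable f) {R : ℝ} (hfR : ∀ x, f x ∈ Set.Icc 0 R)
    {t : ℝ} (ht : 0 ≤ t) :
    ∫⁻ ω, ENNReal.ofReal (1 - (1 + t * ∫ x, f x ∂(D ω)) ^ (-c)) ∂P
      ≤ ENNReal.ofReal c * ∫⁻ x, ENNReal.ofReal (Real.log (1 + t * f x)) ∂ρ := by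
  have hm := (StronglyMeasurable.integral_kernel (κ := D) hf.stronglyMeasurable).measurable
  have hmem : ∀ ω, (1 + t * ∫ x, f x ∂(D ω)) ^ (-c) ∈ Set.Icc (0 : ℝ) 1 := fun ω =>
    rpow_neg_mem_Icc hc (mul_nonneg ht (integral_nonneg fun x => (hfR x).1))
  have hint : Integrable (fun ω => (1 + t * ∫ x, f x ∂(D ω)) ^ (-c)) P :=
    integrable_of_mem_Icc (by fun_prop) hmem
  have hlog : ∀ x, Real.log (1 + t * f x) ∈ Set.Icc 0 (Real.log (1 + t * R)) := by
    intro x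
    have h1 : 0 ≤ t * f x := mul_nonneg ht (hfR x).1
    have := mul_le_mul_of_nonneg_left (hfR x).2 ht
    exact ⟨Real.log_nonneg (by linarith), Real.log_le_log (by linarith) (by linarith)⟩
  have hint' : Integrable (fun ω => 1 - (1 + t * ∫ x, f x ∂(D ω)) ^ (-c)) P :=
    (integrable_const 1).sub hint
  rw [← ofReal_integral_eq_lintegral_ofReal hint'
      (ae_of_all _ fun ω => sub_nonneg.2 (hmem ω).2),
    ← ofReal_integral_eq_lintegral_ofReal (integrable_of_mem_Icc (by fun_prop) hlog)
      (ae_of_all _ fun x => (hlog x).1), ← ENNReal.ofReal_mul hc.le,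
    integral_sub (integrable_const 1) hint, markovKrein_bounded hc hD hf hfR ht]
  refine ENNReal.ofReal_le_ofReal ?_
  have := Real.add_one_le_exp (-c * ∫ x, Real.log (1 + t * f x) ∂ρ)
  simp only [integral_const, probReal_univ, smul_eq_mul, mul_one]
  linarith

theorem mul_le_one_sub_rpow_neg (hc : 0 < c) {y : ℝ} (hy : y ∈ Set.Icc (0 : ℝ) 1) :
    (1 - 2 ^ (-c)) * y ≤ 1 - (1 + y) ^ (-c) := by
  have h1 : y * Real.log 2 ≤ Real.log (1 + y) := by
    have := strictConcaveOn_log_Ioi.concaveOn.2 (show (1 : ℝ) ∈ Set.Ioi 0 by simp)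
      (show (2 : ℝ) ∈ Set.Ioi 0 by simp) (sub_nonneg.2 hy.2) hy.1 (by ring)
    simp only [Real.log_one, smul_eq_mul] at this
    calc y * Real.log 2 ≤ Real.log ((1 - y) * 1 + y * 2) := by linarith
      _ = _ := by ring_nf
  have h2 : Real.exp (y * (-c * Real.log 2)) ≤ (1 - y) + y * Real.exp (-c * Real.log 2) := by
    have := convexOn_exp.2 (Set.mem_univ 0) (Set.mem_univ (-c * Real.log 2))
      (sub_nonneg.2 hy.2) hy.1 (by ring)
    simpa using this
  have h3 : (1 + y) ^ (-c) ≤ Real.exp (y * (-c * Real.log 2)) := by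
    rw [Real.rpow_def_of_pos (by linarith [hy.1])]
    refine Real.exp_le_exp.2 ?_
    nlinarith
  rw [Real.rpow_def_of_pos two_pos, mul_comm (Real.log 2)]
  nlinarith

/-- The intensity measure of a Dirichlet process is dominated by a multiple of `ρ`. -/
theorem exists_bind_le_smul (hc : 0 < c) (hD : IsDirichletProcess P D (ENNReal.ofReal c • ρ)) :
    ∃ K : ENNReal, K ≠ ⊤ ∧ D ∘ₘ P ≤ K • ρ := by
  have h2 : (0 : ℝ) < 1 - 2 ^ (-c) := by
    have : (2 : ℝ) ^ (-c) < 1 := Real.rpow_lt_one_of_one_lt_of_neg one_lt_two (by linarith)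
    linarith
  refine ⟨(ENNReal.ofReal (1 - 2 ^ (-c)))⁻¹ * (ENNReal.ofReal c * ENNReal.ofReal (Real.log 2)),
    ENNReal.mul_ne_top (ENNReal.inv_ne_top.2 (by simpa using h2))
      (ENNReal.mul_ne_top ENNReal.ofReal_ne_top ENNReal.ofReal_ne_top), ?_⟩
  refine Measure.le_iff.2 fun A hA => ?_
  have hfR : ∀ x, A.indicator (fun _ => (1 : ℝ)) x ∈ Set.Icc (0 : ℝ) 1 := by
    intro x
    by_cases hx : x ∈ A <;> simp [hx]
  have key := one_sub_markovKrein_le hc hD (measurable_const.indicator hA) hfR zero_le_one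
  have hlog : ∀ x, ENNReal.ofReal (Real.log (1 + 1 * A.indicator (fun _ => (1 : ℝ)) x))
      = A.indicator (fun _ => ENNReal.ofReal (Real.log 2)) x := by
    intro x
    by_cases hx : x ∈ A <;> simp [hx, one_add_one_eq_two]
  simp_rw [hlog, integral_indicator_const (1 : ℝ) hA, smul_eq_mul, mul_one, one_mul] at key
  rw [lintegral_indicator_const hA] at key
  rw [Measure.bind_apply hA D.measurable.aemeasurable, Measure.smul_apply, smul_eq_mul, mul_assoc,
    mul_comm (_⁻¹), ← div_eq_mul_inv, ENNReal.le_div_iff_mul_le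
      (Or.inl (by simpa using h2)) (Or.inl ENNReal.ofReal_ne_top), mul_comm, mul_assoc]
  refine le_trans ?_ key
  rw [← lintegral_const_mul _ (D.measurable_coe hA)]
  refine lintegral_mono fun ω => ?_
  have : (D ω) A = ENNReal.ofReal ((D ω).real A) := by rw [ofReal_measureReal]
  rw [this, ← ENNReal.ofReal_mul h2.le]
  exact ENNReal.ofReal_le_ofReal
    (mul_le_one_sub_rpow_neg hc ⟨measureReal_nonneg, measureReal_le_one⟩)

theorem rpow_lintegral_le_lintegral_rpow {μ : Measure ℝ} [IsProbabilityMeasure μ]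
    {f : ℝ → ENNReal} (hf : Measurable f) {p : ℝ} (hp : 1 ≤ p) :
    (∫⁻ x, f x ∂μ) ^ p ≤ ∫⁻ x, f x ^ p ∂μ := by
  have := eLpNorm'_le_eLpNorm'_of_exponent_le one_pos hp μ hf.aestronglyMeasurable
  simp only [eLpNorm', enorm_eq_self, ENNReal.rpow_one, one_div, inv_one] at this
  calc _ ≤ ((∫⁻ x, f x ^ p ∂μ) ^ p⁻¹) ^ p := ENNReal.rpow_le_rpow this (by linarith)
    _ = _ := by rw [← ENNReal.rpow_mul, inv_mul_cancel₀ (by linarith), ENNReal.rpow_one]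

theorem lintegral_Ioi_comp_mul {m : ℝ} (hm : 0 < m) {φ : ℝ → ENNReal} (hφ : Measurable φ) :
    ∫⁻ t in Set.Ioi (0 : ℝ), φ t = ENNReal.ofReal m * ∫⁻ t in Set.Ioi (0 : ℝ), φ (m * t) := by
  conv_lhs => rw [← Real.smul_map_volume_mul_left hm.ne']
  rw [Measure.restrict_smul, lintegral_smul_measure,
    setLIntegral_map measurableSet_Ioi hφ (by fun_prop), abs_of_pos hm, smul_eq_mul]
  congr 3
  ext x; simp [hm]

theorem lintegral_rpow_mul_comp_mul {p m : ℝ} (hp : 0 < p) (hm : 0 ≤ m) {φ : ℝ → ℝ}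
    (hφ : Measurable φ) (hφ0 : φ 0 = 0) :
    ∫⁻ t in Set.Ioi (0 : ℝ), ENNReal.ofReal (t ^ (-p - 1) * φ (t * m))
      = ENNReal.ofReal (m ^ p) *
        ∫⁻ t in Set.Ioi (0 : ℝ), ENNReal.ofReal (t ^ (-p - 1) * φ t) := by
  rcases hm.eq_or_lt with rfl | hm
  · simp [hφ0, Real.zero_rpow hp.ne']
  conv_rhs => rw [lintegral_Ioi_comp_mul hm (by fun_prop)]
  rw [← mul_assoc, ← ENNReal.ofReal_mul (by positivity), ← lintegral_const_mul _ (by fun_prop)]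
  refine setLIntegral_congr_fun measurableSet_Ioi fun t ht => ?_
  have ht : (0 : ℝ) < t := ht
  simp only [← ENNReal.ofReal_mul (show 0 ≤ m ^ p * m by positivity)]
  congr 1
  rw [Real.mul_rpow hm.le ht.le, Real.rpow_sub_one hm.ne', Real.rpow_neg hm.le, mul_comm m t]
  have := (Real.rpow_pos_of_pos hm p).ne'
  field_simp

theorem lintegral_rpow_mul_log_ne_top {p : ℝ} (hp : 0 < p) (hp1 : p < 1) :
    ∫⁻ t in Set.Ioi (0 : ℝ), ENNReal.ofReal (t ^ (-p - 1) * Real.log (1 + t)) ≠ ⊤ := by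
  have h1 : ∫⁻ t in Set.Ioc (0 : ℝ) 1, ENNReal.ofReal (t ^ (-p - 1) * Real.log (1 + t)) < ⊤ := by
    have hi : IntegrableOn (fun t : ℝ => t ^ (-p)) (Set.Ioc 0 1) := by
      rw [integrableOn_Ioc_iff_integrableOn_Ioo, intervalIntegral.integrableOn_Ioo_rpow_iff one_pos]
      linarith
    refine lt_of_le_of_lt (setLIntegral_mono' measurableSet_Ioc fun t ht => ?_)
      (Integrable.lintegral_lt_top hi)
    refine ENNReal.ofReal_le_ofReal ?_
    have : t ^ (-p) = t ^ (-p - 1) * t := by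
      rw [Real.rpow_sub_one ht.1.ne', div_mul_cancel₀ _ ht.1.ne']
    rw [this]
    refine mul_le_mul_of_nonneg_left ?_ (Real.rpow_nonneg ht.1.le _)
    linarith [Real.log_le_sub_one_of_pos (show 0 < 1 + t by linarith [ht.1])]
  have h2 : ∫⁻ t in Set.Ioi (1 : ℝ), ENNReal.ofReal (t ^ (-p - 1) * Real.log (1 + t)) < ⊤ := by
    have hi : IntegrableOn (fun t : ℝ => 2 ^ (p / 2) / (p / 2) * t ^ (-p / 2 - 1)) (Set.Ioi 1) :=
      (integrableOn_Ioi_rpow_of_lt (by linarith) one_pos).const_mul _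
    refine lt_of_le_of_lt (setLIntegral_mono' measurableSet_Ioi fun t ht => ?_)
      (Integrable.lintegral_lt_top hi)
    have ht : (1 : ℝ) < t := ht
    have ht0 : (0 : ℝ) < t := by linarith
    refine ENNReal.ofReal_le_ofReal ?_
    have h3 : Real.log (1 + t) ≤ 2 ^ (p / 2) / (p / 2) * t ^ (p / 2) := by
      calc Real.log (1 + t) ≤ (1 + t) ^ (p / 2) / (p / 2) :=
            Real.log_le_rpow_div (by linarith) (by linarith)
        _ ≤ (2 * t) ^ (p / 2) / (p / 2) := by
            gcongr
            linarith
        _ = _ := by rw [Real.mul_rpow (by norm_num) ht0.le]; ring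
    calc _ ≤ t ^ (-p - 1) * (2 ^ (p / 2) / (p / 2) * t ^ (p / 2)) := by gcongr
      _ = 2 ^ (p / 2) / (p / 2) * (t ^ (-p - 1) * t ^ (p / 2)) := by ring
      _ = _ := by rw [← Real.rpow_add ht0]; ring_nf
  rw [← Set.Ioc_union_Ioi_eq_Ioi zero_le_one]
  exact ((lintegral_union_le _ _ _).trans_lt (ENNReal.add_lt_top.2 ⟨h1, h2⟩)).ne

theorem lintegral_rpow_mul_one_sub_ne_zero {p : ℝ} (hc : 0 < c) :
    ∫⁻ t in Set.Ioi (0 : ℝ), ENNReal.ofReal (t ^ (-p - 1) * (1 - (1 + t) ^ (-c))) ≠ 0 := by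
  rw [Ne, setLIntegral_eq_zero_iff measurableSet_Ioi (by fun_prop)]
  intro h
  have h0 : ∀ᵐ t : ℝ, t ∉ Set.Ioi (0 : ℝ) := by
    filter_upwards [h] with t ht htp
    have htp' : (0 : ℝ) < t := htp
    have h3 := ht htp
    rw [ENNReal.ofReal_eq_zero] at h3
    have : (1 + t) ^ (-c) < 1 := Real.rpow_lt_one_of_one_lt_of_neg (by linarith) (by linarith)
    have : 0 < t ^ (-p - 1) * (1 - (1 + t) ^ (-c)) :=
      mul_pos (by positivity) (by linarith)
    linarith
  rw [ae_iff] at h0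
  simp only [Set.mem_Ioi, not_not] at h0
  exact (by simp : volume (Set.Ioi (0 : ℝ)) ≠ 0) h0

theorem exists_lintegral_rpow_integral_le (hc : 0 < c)
    (hD : IsDirichletProcess P D (ENNReal.ofReal c • ρ)) {p : ℝ} (hp : 0 < p) (hp1 : p < 1) :
    ∃ K : ENNReal, K ≠ ⊤ ∧ ∀ (f : ℝ → ℝ) (R : ℝ), Measurable f → (∀ x, f x ∈ Set.Icc 0 R) →
      ∫⁻ ω, ENNReal.ofReal ((∫ x, f x ∂(D ω)) ^ p) ∂P
        ≤ K * ∫⁻ x, ENNReal.ofReal (f x ^ p) ∂ρ := by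
  set C := ∫⁻ t in Set.Ioi (0 : ℝ), ENNReal.ofReal (t ^ (-p - 1) * (1 - (1 + t) ^ (-c))) with hC
  set C' := ∫⁻ t in Set.Ioi (0 : ℝ), ENNReal.ofReal (t ^ (-p - 1) * Real.log (1 + t)) with hC'
  have hC0 : C ≠ 0 := lintegral_rpow_mul_one_sub_ne_zero hc
  have hCt' : C' ≠ ⊤ := lintegral_rpow_mul_log_ne_top hp hp1
  have hCt : C ≠ ⊤ := by
    have : C ≤ ENNReal.ofReal c * C' := by
      rw [hC, hC', ← lintegral_const_mul _ (by fun_prop)]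
      refine setLIntegral_mono' measurableSet_Ioi fun t ht => ?_
      have ht : (0 : ℝ) < t := ht
      rw [← ENNReal.ofReal_mul hc.le]
      refine ENNReal.ofReal_le_ofReal ?_
      have := Real.add_one_le_exp (Real.log (1 + t) * -c)
      rw [← Real.rpow_def_of_pos (by linarith)] at this
      calc _ ≤ t ^ (-p - 1) * (c * Real.log (1 + t)) := by gcongr; linarith
        _ = _ := by ring
    exact (this.trans_lt (ENNReal.mul_lt_top ENNReal.ofReal_lt_top hCt'.lt_top)).ne
  refine ⟨ENNReal.ofReal c * C' / C, ENNReal.div_ne_top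
    (ENNReal.mul_ne_top ENNReal.ofReal_ne_top hCt') hC0, fun f R hf hfR => ?_⟩
  have hm := (StronglyMeasurable.integral_kernel (κ := D) hf.stronglyMeasurable).measurable
  set X : Ω → ℝ := fun ω => ∫ x, f x ∂(D ω) with hX
  have hX0 : ∀ ω, 0 ≤ X ω := fun ω => integral_nonneg fun x => (hfR x).1
  have e1 : (∫⁻ ω, ENNReal.ofReal (X ω ^ p) ∂P) * C
      = ∫⁻ t in Set.Ioi (0 : ℝ), ENNReal.ofReal (t ^ (-p - 1)) *
        ∫⁻ ω, ENNReal.ofReal (1 - (1 + t * X ω) ^ (-c)) ∂P := by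
    rw [← lintegral_mul_const _ (by fun_prop)]
    have : ∀ ω, ENNReal.ofReal (X ω ^ p) * C
        = ∫⁻ t in Set.Ioi (0 : ℝ),
          ENNReal.ofReal (t ^ (-p - 1) * (1 - (1 + t * X ω) ^ (-c))) := fun ω =>
      (lintegral_rpow_mul_comp_mul hp (hX0 ω) (φ := fun t => 1 - (1 + t) ^ (-c))
        (by fun_prop) (by simp)).symm
    simp_rw [this]
    rw [lintegral_lintegral_swap (by fun_prop)]
    refine setLIntegral_congr_fun measurableSet_Ioi fun t ht => ?_
    have ht : (0 : ℝ) < t := ht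
    simp only [← lintegral_const_mul' _ _ ENNReal.ofReal_ne_top,
      ← ENNReal.ofReal_mul (show 0 ≤ t ^ (-p - 1) by positivity)]
  have e2 : (∫⁻ x, ENNReal.ofReal (f x ^ p) ∂ρ) * C'
      = ∫⁻ t in Set.Ioi (0 : ℝ), ENNReal.ofReal (t ^ (-p - 1)) *
        ∫⁻ x, ENNReal.ofReal (Real.log (1 + t * f x)) ∂ρ := by
    rw [← lintegral_mul_const _ (by fun_prop)]
    have : ∀ x, ENNReal.ofReal (f x ^ p) * C'
        = ∫⁻ t in Set.Ioi (0 : ℝ),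
          ENNReal.ofReal (t ^ (-p - 1) * Real.log (1 + t * f x)) := fun x =>
      (lintegral_rpow_mul_comp_mul hp (hfR x).1 (φ := fun t => Real.log (1 + t))
        (by fun_prop) (by simp)).symm
    simp_rw [this]
    rw [lintegral_lintegral_swap (by fun_prop)]
    refine setLIntegral_congr_fun measurableSet_Ioi fun t ht => ?_
    have ht : (0 : ℝ) < t := ht
    simp only [← lintegral_const_mul' _ _ ENNReal.ofReal_ne_top,
      ← ENNReal.ofReal_mul (show 0 ≤ t ^ (-p - 1) by positivity)]
  rw [mul_comm, ← mul_div_assoc, ENNReal.le_div_iff_mul_le (Or.inl hC0) (Or.inl hCt), e1,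
    mul_comm (ENNReal.ofReal c), ← mul_assoc, e2, mul_comm, ← lintegral_const_mul' _ _ ENNReal.ofReal_ne_top]
  refine setLIntegral_mono' measurableSet_Ioi fun t ht => ?_
  have ht : (0 : ℝ) < t := ht
  rw [mul_left_comm]
  gcongr
  exact one_sub_markovKrein_le hc hD hf hfR ht.le

/-- The moments of the random mean are controlled by those of `ρ`. -/
theorem exists_lintegral_rpow_lintegral_le (hc : 0 < c)
    (hD : IsDirichletProcess P D (ENNReal.ofReal c • ρ)) {p : ℝ} (hp : 0 < p) :
    ∃ K : ENNReal, K ≠ ⊤ ∧ ∫⁻ ω, (∫⁻ x, ENNReal.ofReal x ∂(D ω)) ^ p ∂P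
        ≤ K * ∫⁻ x, ENNReal.ofReal x ^ p ∂ρ := by
  rcases le_or_gt 1 p with hp1 | hp1
  · obtain ⟨K, hK, hle⟩ := exists_bind_le_smul hc hD
    refine ⟨K, hK, ?_⟩
    calc _ ≤ ∫⁻ ω, ∫⁻ x, ENNReal.ofReal x ^ p ∂(D ω) ∂P :=
          lintegral_mono fun ω => rpow_lintegral_le_lintegral_rpow (by fun_prop) hp1
      _ = ∫⁻ x, ENNReal.ofReal x ^ p ∂(D ∘ₘ P) :=
          (Measure.lintegral_bind D.measurable.aemeasurable (by fun_prop)).symm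
      _ ≤ ∫⁻ x, ENNReal.ofReal x ^ p ∂(K • ρ) := lintegral_mono' hle le_rfl
      _ = _ := by rw [lintegral_smul_measure, smul_eq_mul]
  · obtain ⟨K, hK, hle⟩ := exists_lintegral_rpow_integral_le hc hD hp hp1
    refine ⟨K, hK, ?_⟩
    set f : ℕ → ℝ → ℝ := fun k x => min (max x 0) k with hf
    have hfR : ∀ (k : ℕ) x, f k x ∈ Set.Icc (0 : ℝ) k := fun k x =>
      ⟨le_min (le_max_right _ _) (Nat.cast_nonneg k), min_le_right _ _⟩
    have hfm : ∀ k, Measurable (f k) := fun k => by fun_prop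
    have hmono : ∀ x, Monotone fun k => ENNReal.ofReal (f k x) := fun x i j hij =>
      ENNReal.ofReal_le_ofReal (min_le_min_left _ (by exact_mod_cast hij))
    have hlim : ∀ x, Tendsto (fun k => ENNReal.ofReal (f k x)) atTop (𝓝 (ENNReal.ofReal x)) := by
      intro x
      refine tendsto_const_nhds.congr' ?_
      filter_upwards [eventually_ge_atTop ⌈max x 0⌉₊] with k hk
      rw [hf]
      simp only [min_eq_left (Nat.ceil_le.1 hk)]
      rcases le_total x 0 with h | h
      · rw [max_eq_right h, ENNReal.ofReal_of_nonpos h, ENNReal.ofReal_zero]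
      · rw [max_eq_left h]
    have hDlim : ∀ ω, Tendsto (fun k => ∫⁻ x, ENNReal.ofReal (f k x) ∂(D ω)) atTop
        (𝓝 (∫⁻ x, ENNReal.ofReal x ∂(D ω))) := fun ω =>
      lintegral_tendsto_of_tendsto_of_monotone (fun k => by fun_prop) (ae_of_all _ hmono)
        (ae_of_all _ hlim)
    have hPlim : Tendsto (fun k => ∫⁻ ω, (∫⁻ x, ENNReal.ofReal (f k x) ∂(D ω)) ^ p ∂P) atTop
        (𝓝 (∫⁻ ω, (∫⁻ x, ENNReal.ofReal x ∂(D ω)) ^ p ∂P)) := by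
      refine lintegral_tendsto_of_tendsto_of_monotone (fun k => ?_) (ae_of_all _ fun ω i j hij => ?_)
        (ae_of_all _ fun ω => (hDlim ω).ennrpow_const p)
      · have : Measurable fun ω => ∫⁻ x, ENNReal.ofReal (f k x) ∂(D ω) :=
          Measurable.lintegral_kernel (by fun_prop)
        fun_prop
      · exact ENNReal.rpow_le_rpow (lintegral_mono fun x => hmono x hij) hp.le
    refine le_of_tendsto hPlim (Eventually.of_forall fun k => ?_)
    have e1 : ∀ ω, (∫⁻ x, ENNReal.ofReal (f k x) ∂(D ω)) ^ p
        = ENNReal.ofReal ((∫ x, f k x ∂(D ω)) ^ p) := by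
      intro ω
      rw [← ofReal_integral_eq_lintegral_ofReal (integrable_of_mem_Icc (hfm k) (hfR k))
        (ae_of_all _ fun x => (hfR k x).1), ENNReal.ofReal_rpow_of_nonneg
        (integral_nonneg fun x => (hfR k x).1) hp.le]
    simp_rw [e1]
    refine (hle (f k) k (hfm k) (hfR k)).trans ?_
    gcongr with x
    rw [← ENNReal.ofReal_rpow_of_nonneg (hfR k x).1 hp.le]
    refine ENNReal.rpow_le_rpow ((hmono x).ge_of_tendsto (hlim x) k) hp.le

end

/-! ### Integrals along Hankel loops -/

/-- `e^{uz} (1 - m e^{-z})^{-c}` with the principal branch of the power. -/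
noncomputable def hankelKernel (c : ℝ) (u : ℂ) (m : ℝ) (z : ℂ) : ℂ :=
  Complex.exp (u * z - c * Complex.log (1 - m * Complex.exp (-z)))

theorem re_one_sub_mul_exp_neg (m : ℝ) (z : ℂ) :
    (1 - m * Complex.exp (-z)).re = 1 - m * Real.exp (-z.re) * Real.cos z.im := by
  simp [Complex.exp_re, mul_assoc]

theorem im_one_sub_mul_exp_neg (m : ℝ) (z : ℂ) :
    (1 - m * Complex.exp (-z)).im = m * Real.exp (-z.re) * Real.sin z.im := by
  simp [Complex.exp_im, mul_assoc]

theorem norm_ofReal_mul_exp_neg {m : ℝ} (hm : 0 ≤ m) (z : ℂ) :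
    ‖(m : ℂ) * Complex.exp (-z)‖ = m * Real.exp (-z.re) := by
  rw [norm_mul, Complex.norm_real, Real.norm_of_nonneg hm, Complex.norm_exp, Complex.neg_re]

theorem cos_nonpos_of_sin_eq_zero {y : ℝ} (hy : 0 < |y| ∧ |y| < 2 * Real.pi)
    (h : Real.sin y = 0) : Real.cos y ≤ 0 := by
  rcases Real.sin_eq_zero_iff_cos_eq.1 h with h1 | h1
  · exfalso
    obtain ⟨k, hk⟩ := (Real.cos_eq_one_iff y).1 h1
    rw [← hk, abs_mul, abs_of_pos (show 0 < 2 * Real.pi by positivity)] at hy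
    have h2 : |(k : ℝ)| < 1 := by
      by_contra! h3
      nlinarith [Real.pi_pos, hy.2]
    have : k = 0 := by rw [← Int.abs_lt_one_iff]; exact_mod_cast h2
    simp [this] at hy
  · linarith

/-- Away from the cut, `1 - m e^{-z}` is bounded below on horizontal lines, uniformly in `m`. -/
theorem exists_le_norm_one_sub_mul_exp_neg {y : ℝ} (hy : 0 < |y| ∧ |y| < 2 * Real.pi) :
    ∃ δ : ℝ, 0 < δ ∧ ∀ m : ℝ, 0 ≤ m → ∀ z : ℂ, z.im = y →
      δ ≤ ‖1 - m * Complex.exp (-z)‖ := by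
  rcases le_or_gt (Real.cos y) 0 with h | h
  · refine ⟨1, one_pos, fun m hm z hz => ?_⟩
    refine le_trans ?_ (Complex.re_le_norm _)
    rw [re_one_sub_mul_exp_neg, hz]
    have := mul_nonneg hm (Real.exp_pos (-z.re)).le
    nlinarith
  · have hs : Real.sin y ≠ 0 := fun h0 => by linarith [cos_nonpos_of_sin_eq_zero hy h0]
    refine ⟨|Real.sin y|, abs_pos.2 hs, fun m hm z hz => ?_⟩
    rw [← Real.sqrt_sq_eq_abs, Complex.norm_eq_sqrt_sq_add_sq]
    refine Real.sqrt_le_sqrt ?_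
    rw [re_one_sub_mul_exp_neg, im_one_sub_mul_exp_neg, hz]
    set r := m * Real.exp (-z.re)
    nlinarith [Real.sin_sq_add_cos_sq y, sq_nonneg (r - Real.cos y)]

theorem one_sub_mul_exp_neg_mem_slitPlane {m : ℝ} (hm : 0 ≤ m) {z : ℂ}
    (h : m * Real.exp (-z.re) < 1 ∨ (0 < |z.im| ∧ |z.im| < 2 * Real.pi)) :
    1 - m * Complex.exp (-z) ∈ Complex.slitPlane := by
  rw [Complex.mem_slitPlane_iff, re_one_sub_mul_exp_neg, im_one_sub_mul_exp_neg]
  have hr : 0 ≤ m * Real.exp (-z.re) := by positivity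
  set r := m * Real.exp (-z.re)
  rcases h with h | h
  · left; nlinarith [Real.cos_le_one z.im]
  · by_cases h0 : Real.sin z.im = 0
    · left; nlinarith [cos_nonpos_of_sin_eq_zero h h0]
    · rcases hr.eq_or_lt with h1 | h1
      · left; rw [← h1]; simp
      · right; exact mul_ne_zero h1.ne' h0

theorem norm_hankelKernel {c : ℝ} {u : ℂ} {m : ℝ} {z : ℂ}
    (h : 1 - m * Complex.exp (-z) ≠ 0) :
    ‖hankelKernel c u m z‖
      = Real.exp (u.re * z.re - u.im * z.im) * ‖1 - m * Complex.exp (-z)‖ ^ (-c) := by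
  rw [hankelKernel, Complex.norm_exp, Real.rpow_def_of_pos (norm_pos_iff.2 h), ← Real.exp_add]
  congr 1
  simp [Complex.log_re]
  ring

theorem norm_hankelKernel_le {c : ℝ} (hc : 0 ≤ c) {u : ℂ} {m : ℝ} {z : ℂ} {δ B : ℝ} (hδ : 0 < δ)
    (h : δ ≤ ‖1 - m * Complex.exp (-z)‖) (hB : |z.im| ≤ B) :
    ‖hankelKernel c u m z‖ ≤ δ ^ (-c) * Real.exp (|u.im| * B) * Real.exp (u.re * z.re) := by
  rw [norm_hankelKernel (norm_pos_iff.1 (hδ.trans_le h)), sub_eq_add_neg, Real.exp_add]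
  have h1 : -(u.im * z.im) ≤ |u.im| * B := by
    refine (neg_le_abs _).trans ?_
    rw [abs_mul]
    gcongr
  have h2 : ‖1 - m * Complex.exp (-z)‖ ^ (-c) ≤ δ ^ (-c) :=
    Real.rpow_le_rpow_of_nonpos hδ h (by linarith)
  calc _ ≤ Real.exp (u.re * z.re) * Real.exp (|u.im| * B) * δ ^ (-c) := by gcongr
    _ = _ := by ring

/-- A weighted path on which the kernels `(1 - m e^{-z})^{-c}`, `0 ≤ m ≤ R`, are uniformly
bounded and the exponentials `e^{az}`, `a > 0`, are integrable. -/
structure IsHankelPath (R : ℝ) (κ : Measure ℝ) (p : ℝ → ℂ) : Prop where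
  continuous : Continuous p
  exists_le_norm : ∃ δ : ℝ, 0 < δ ∧ ∀ᵐ t ∂κ, ∀ m ∈ Set.Icc 0 R,
    δ ≤ ‖1 - m * Complex.exp (-p t)‖
  mem_slitPlane : ∀ᵐ t ∂κ, ∀ m ∈ Set.Icc 0 R, 1 - m * Complex.exp (-p t) ∈ Complex.slitPlane
  exists_im_le : ∃ B : ℝ, ∀ᵐ t ∂κ, |(p t).im| ≤ B
  integrable_exp : ∀ a : ℝ, 0 < a → Integrable (fun t => Real.exp (a * (p t).re)) κ

theorem isHankelPath_horizontal (R b : ℝ) {y : ℝ} (hy : 0 < |y| ∧ |y| < 2 * Real.pi) :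
    IsHankelPath R (volume.restrict (Set.Iic b)) (fun t => t + y * Complex.I) where
  continuous := by fun_prop
  exists_le_norm := by
    obtain ⟨δ, hδ, h⟩ := exists_le_norm_one_sub_mul_exp_neg hy
    exact ⟨δ, hδ, ae_of_all _ fun t m hm => h m hm.1 _ (by simp)⟩
  mem_slitPlane := ae_of_all _ fun t m hm =>
    one_sub_mul_exp_neg_mem_slitPlane hm.1 (Or.inr (by simpa using hy))
  exists_im_le := ⟨|y|, ae_of_all _ fun t => by simp⟩
  integrable_exp a ha := by
    simpa [IntegrableOn] using integrableOn_exp_mul_Iic ha b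

theorem mul_exp_neg_lt_one {R b : ℝ} (hR : 0 < R) (hb : Real.log R < b) :
    R * Real.exp (-b) < 1 := by
  rw [Real.exp_neg, ← div_eq_mul_inv, div_lt_one (Real.exp_pos b)]
  exact (Real.log_lt_iff_lt_exp hR).1 hb

theorem isHankelPath_vertical {R b : ℝ} (hR : 0 < R) (hb : Real.log R < b) (η : ℝ) :
    IsHankelPath R (volume.restrict (Set.uIoc (-η) η)) (fun y => b + y * Complex.I) where
  continuous := by fun_prop
  exists_le_norm := by
    refine ⟨1 - R * Real.exp (-b), by linarith [mul_exp_neg_lt_one hR hb],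
      ae_of_all _ fun y m hm => ?_⟩
    have h := norm_sub_norm_le (1 : ℂ) (m * Complex.exp (-(b + y * Complex.I)))
    rw [norm_ofReal_mul_exp_neg hm.1] at h
    simp only [norm_one, Complex.add_re, Complex.ofReal_re, Complex.mul_re, Complex.I_re, mul_zero,
      Complex.ofReal_im, Complex.I_im, mul_one, sub_zero, add_zero] at h
    have := mul_le_mul_of_nonneg_right hm.2 (Real.exp_pos (-b)).le
    linarith
  mem_slitPlane := ae_of_all _ fun y m hm => by
    refine one_sub_mul_exp_neg_mem_slitPlane hm.1 (Or.inl ?_)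
    have := mul_le_mul_of_nonneg_right hm.2 (Real.exp_pos (-b)).le
    simpa using this.trans_lt (mul_exp_neg_lt_one hR hb)
  exists_im_le := by
    refine ⟨|η|, ?_⟩
    filter_upwards [ae_restrict_mem measurableSet_uIoc] with y hy
    rw [Set.mem_uIoc] at hy
    simp only [Complex.add_im, Complex.ofReal_im, Complex.mul_im, Complex.ofReal_re, Complex.I_im,
      mul_one, Complex.I_re, mul_zero, add_zero, zero_add]
    rw [abs_le]
    rcases hy with hy | hy <;> constructor <;> linarith [le_abs_self η, neg_abs_le η, hy.1, hy.2]
  integrable_exp a _ := by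
    have : IsFiniteMeasure (volume.restrict (Set.uIoc (-η) η)) :=
      ⟨by simp [Set.uIoc]⟩
    simp

namespace IsHankelPath

variable {R : ℝ} {κ : Measure ℝ} {p : ℝ → ℂ}

theorem exists_norm_hankelKernel_le (h : IsHankelPath R κ p) (u : ℂ) (c₀ : ℝ) :
    ∃ C : ℝ, ∀ᵐ t ∂κ, ∀ c ∈ Set.Icc 0 c₀, ∀ m ∈ Set.Icc 0 R,
      ‖hankelKernel c u m (p t)‖ ≤ C * Real.exp (u.re * (p t).re) := by
  obtain ⟨δ, hδ, h1⟩ := h.exists_le_norm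
  obtain ⟨B, h2⟩ := h.exists_im_le
  refine ⟨(min δ 1) ^ (-c₀) * Real.exp (|u.im| * B), ?_⟩
  filter_upwards [h1, h2] with t h1 h2 c hc m hm
  refine (norm_hankelKernel_le hc.1 (lt_min hδ one_pos) ((min_le_left _ _).trans (h1 m hm)) h2).trans
    ?_
  have : (min δ 1) ^ (-c) ≤ (min δ 1) ^ (-c₀) :=
    Real.rpow_le_rpow_of_exponent_ge (lt_min hδ one_pos) (min_le_right _ _) (by linarith [hc.2])
  gcongr

theorem aestronglyMeasurable_hankelKernel (h : IsHankelPath R κ p) (c : ℝ) (u : ℂ) (m : ℝ) :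
    AEStronglyMeasurable (fun t => hankelKernel c u m (p t)) κ := by
  have := h.continuous.measurable
  unfold hankelKernel
  exact Measurable.aestronglyMeasurable (by fun_prop)

theorem integrable_hankelKernel (h : IsHankelPath R κ p) {c : ℝ} (hc : 0 ≤ c) {u : ℂ}
    (hu : 0 < u.re) {m : ℝ} (hm : m ∈ Set.Icc 0 R) :
    Integrable (fun t => hankelKernel c u m (p t)) κ := by
  obtain ⟨C, hC⟩ := h.exists_norm_hankelKernel_le u c
  refine Integrable.mono' ((h.integrable_exp u.re hu).const_mul C)
    (h.aestronglyMeasurable_hankelKernel c u m) ?_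
  filter_upwards [hC] with t ht using ht c ⟨hc, le_rfl⟩ m hm

theorem continuousAt_integral_hankelKernel (h : IsHankelPath R κ p) {u : ℂ} (hu : 0 < u.re)
    {m : ℝ} (hm : m ∈ Set.Icc 0 R) {c₀ : ℝ} (hc₀ : 0 < c₀) :
    ContinuousAt (fun c : ℝ => ∫ t, hankelKernel c u m (p t) ∂κ) c₀ := by
  obtain ⟨C, hC⟩ := h.exists_norm_hankelKernel_le u (c₀ + 1)
  refine continuousAt_of_dominated (bound := fun t => C * Real.exp (u.re * (p t).re))
    (Eventually.of_forall fun c => h.aestronglyMeasurable_hankelKernel c u m) ?_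
    ((h.integrable_exp u.re hu).const_mul C) (ae_of_all _ fun t => ?_)
  · filter_upwards [Ioo_mem_nhds hc₀ (lt_add_one c₀)] with c hc
    filter_upwards [hC] with t ht using ht c ⟨hc.1.le, hc.2.le⟩ m hm
  · unfold hankelKernel
    fun_prop

end IsHankelPath

section Loop

variable {f g : ℂ → ℂ} {b η : ℝ}

theorem abs_neg_and {η : ℝ} (h0 : 0 < η) (h2 : η < 2 * Real.pi) :
    (0 < |η| ∧ |η| < 2 * Real.pi) ∧ (0 < |-η| ∧ |-η| < 2 * Real.pi) := by
  rw [abs_neg, abs_of_pos h0]; exact ⟨⟨h0, h2⟩, ⟨h0, h2⟩⟩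

theorem isHankelPath_lower (R b : ℝ) {η : ℝ} (h0 : 0 < η) (h2 : η < 2 * Real.pi) :
    IsHankelPath R (volume.restrict (Set.Iic b)) (fun t => t - η * Complex.I) := by
  simpa [sub_eq_add_neg] using isHankelPath_horizontal R b (abs_neg_and h0 h2).2

theorem isHankelPath_upper (R b : ℝ) {η : ℝ} (h0 : 0 < η) (h2 : η < 2 * Real.pi) :
    IsHankelPath R (volume.restrict (Set.Iic b)) (fun t => t + η * Complex.I) :=
  isHankelPath_horizontal R b (abs_neg_and h0 h2).1

theorem hankelIntegrable_iff : HankelIntegrable f b η ↔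
    Integrable (fun t : ℝ => f (t - η * Complex.I)) (volume.restrict (Set.Iic b)) ∧
    Integrable (fun y : ℝ => f (b + y * Complex.I)) (volume.restrict (Set.uIoc (-η) η)) ∧
    Integrable (fun t : ℝ => f (t + η * Complex.I)) (volume.restrict (Set.Iic b)) := by
  rw [HankelIntegrable, intervalIntegrable_iff]; rfl

theorem hankelIntegral_eq (hη : 0 ≤ η) : hankelIntegral f b η =
    (∫ t : ℝ, f (t - η * Complex.I) ∂(volume.restrict (Set.Iic b)))
      + Complex.I * (∫ y : ℝ, f (b + y * Complex.I) ∂(volume.restrict (Set.uIoc (-η) η)))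
      - ∫ t : ℝ, f (t + η * Complex.I) ∂(volume.restrict (Set.Iic b)) := by
  rw [hankelIntegral, intervalIntegral.integral_of_le (by linarith), Set.uIoc_of_le (by linarith)]

theorem hankelIntegral_sub (hf : HankelIntegrable f b η) (hg : HankelIntegrable g b η) :
    hankelIntegral (fun z => f z - g z) b η = hankelIntegral f b η - hankelIntegral g b η := by
  unfold hankelIntegral
  rw [integral_sub hf.1 hg.1, integral_sub hf.2.2 hg.2.2, intervalIntegral.integral_sub hf.2.1 hg.2.1]
  ring

theorem hankelIntegral_const_mul (a : ℂ) :
    hankelIntegral (fun z => a * f z) b η = a * hankelIntegral f b η := by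
  unfold hankelIntegral
  rw [integral_const_mul, integral_const_mul, intervalIntegral.integral_const_mul]
  ring

theorem hankelIntegral_comp_add (a : ℝ) :
    hankelIntegral (fun z => f (z + a)) (b - a) η = hankelIntegral f b η := by
  have h : ∀ φ : ℝ → ℂ, ∫ t in Set.Iic (b - a), φ (t + a) = ∫ t in Set.Iic b, φ t := by
    intro φ
    have := (measurePreserving_add_right (volume : Measure ℝ) a).setIntegral_preimage_emb
      (measurableEmbedding_addRight a) φ (Set.Iic b)
    simpa using this
  unfold hankelIntegral
  rw [← h fun t => f (t - η * Complex.I), ← h fun t => f (t + η * Complex.I)]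
  push_cast
  simp only [sub_add_eq_add_sub, add_right_comm]
  simp only [add_sub_right_comm, sub_add_cancel]

/-- The integral of a derivative along a Hankel loop vanishes. -/
theorem hankelIntegral_deriv_eq_zero {G : ℂ → ℂ}
    (hG1 : ∀ t ≤ b, HasDerivAt G (f (t - η * Complex.I)) (t - η * Complex.I))
    (hG2 : ∀ y : ℝ, HasDerivAt G (f (b + y * Complex.I)) (b + y * Complex.I))
    (hG3 : ∀ t ≤ b, HasDerivAt G (f (t + η * Complex.I)) (t + η * Complex.I))
    (hf : HankelIntegrable f b η)
    (hl1 : Tendsto (fun t : ℝ => G (t - η * Complex.I)) atBot (𝓝 0))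
    (hl3 : Tendsto (fun t : ℝ => G (t + η * Complex.I)) atBot (𝓝 0)) :
    hankelIntegral f b η = 0 := by
  have e1 : ∫ t in Set.Iic b, f (t - η * Complex.I) = G (b - η * Complex.I) - 0 := by
    refine integral_Iic_of_hasDerivAt_of_tendsto' (f := fun t : ℝ => G (t - η * Complex.I))
      (fun t ht => ?_) hf.1 hl1
    have := (hG1 t ht).comp_of_eq (h := fun t : ℂ => t - η * Complex.I) (x := (t : ℂ))
      ((hasDerivAt_id _).sub_const _) rfl
    simpa using this.comp_ofReal
  have e3 : ∫ t in Set.Iic b, f (t + η * Complex.I) = G (b + η * Complex.I) - 0 := by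
    refine integral_Iic_of_hasDerivAt_of_tendsto' (f := fun t : ℝ => G (t + η * Complex.I))
      (fun t ht => ?_) hf.2.2 hl3
    have := (hG3 t ht).comp_of_eq (h := fun t : ℂ => t + η * Complex.I) (x := (t : ℂ))
      ((hasDerivAt_id _).add_const _) rfl
    simpa using this.comp_ofReal
  have e2 : ∫ y in (-η)..η, f (b + y * Complex.I) * Complex.I
      = G (b + η * Complex.I) - G (b + (-η : ℝ) * Complex.I) := by
    refine intervalIntegral.integral_eq_sub_of_hasDerivAt
      (f := fun y : ℝ => G (b + y * Complex.I)) (fun y _ => ?_) (hf.2.1.mul_const _)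
    have := (hG2 y).comp_of_eq (h := fun y : ℂ => b + y * Complex.I) (x := (y : ℂ))
      (((hasDerivAt_id _).mul_const _).const_add _) rfl
    simpa using this.comp_ofReal
  rw [intervalIntegral.integral_mul_const, mul_comm] at e2
  unfold hankelIntegral
  rw [e1, e2, e3]
  push_cast
  ring_nf

end Loop

/-- Cauchy's theorem on a half-strip unbounded to the left. -/
theorem integral_Iic_rect_eq_zero {f : ℂ → ℂ} {b y₁ y₂ C a : ℝ} (ha : 0 < a)
    (hd : DifferentiableOn ℂ f (Set.Iic b ×ℂ Set.uIcc y₁ y₂))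
    (h₁ : IntegrableOn (fun t : ℝ => f (t + y₁ * Complex.I)) (Set.Iic b))
    (h₂ : IntegrableOn (fun t : ℝ => f (t + y₂ * Complex.I)) (Set.Iic b))
    (hC : ∀ᶠ x : ℝ in atBot, ∀ y ∈ Set.uIcc y₁ y₂,
      ‖f (x + y * Complex.I)‖ ≤ C * Real.exp (a * x)) :
    (∫ t in Set.Iic b, f (t + y₁ * Complex.I)) - (∫ t in Set.Iic b, f (t + y₂ * Complex.I))
      + Complex.I * ∫ y in y₁..y₂, f (b + y * Complex.I) = 0 := by
  have hrect : ∀ᶠ T : ℝ in atBot,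
      (((∫ t in T..b, f (t + y₁ * Complex.I)) - ∫ t in T..b, f (t + y₂ * Complex.I))
        + Complex.I * ∫ y in y₁..y₂, f (b + y * Complex.I))
        - Complex.I * ∫ y in y₁..y₂, f (T + y * Complex.I) = 0 := by
    filter_upwards [eventually_le_atBot b] with T hT
    have := Complex.integral_boundary_rect_eq_zero_of_differentiableOn f (T + y₁ * Complex.I)
      (b + y₂ * Complex.I) (hd.mono ?_)
    · simpa using this
    · refine Complex.reProdIm_subset_iff.2 (Set.prod_mono ?_ ?_)
      · simp only [Complex.add_re, Complex.ofReal_re, Complex.mul_re, Complex.I_re, mul_zero,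
          Complex.ofReal_im, Complex.I_im, mul_one, sub_self, add_zero, Set.uIcc_of_le hT]
        exact Set.Icc_subset_Iic_self
      · simp
  have hleft : Tendsto (fun T : ℝ => ∫ y in y₁..y₂, f (T + y * Complex.I)) atBot (𝓝 0) := by
    refine squeeze_zero_norm' (a := fun T => C * Real.exp (a * T) * |y₂ - y₁|) ?_ ?_
    · filter_upwards [hC] with T hT
      exact intervalIntegral.norm_integral_le_of_norm_le_const fun y hy =>
        hT y (Set.uIoc_subset_uIcc hy)
    · have : Tendsto (fun T : ℝ => Real.exp (a * T)) atBot (𝓝 0) :=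
        Real.tendsto_exp_atBot.comp (tendsto_id.const_mul_atBot ha)
      simpa using (this.const_mul C).mul_const |y₂ - y₁|
  have hlim := (((intervalIntegral_tendsto_integral_Iic b h₁ tendsto_id).sub
    (intervalIntegral_tendsto_integral_Iic b h₂ tendsto_id)).add_const
      (Complex.I * ∫ y in y₁..y₂, f (b + y * Complex.I))).sub (hleft.const_mul Complex.I)
  have := tendsto_nhds_unique hlim ((tendsto_congr' hrect).2 tendsto_const_nhds)
  simpa using this

/-- Hankel loops of different heights give the same integral. -/
theorem hankelIntegral_eq_of_le {f : ℂ → ℂ} {b ε η C a : ℝ} (ha : 0 < a) (hε : 0 < ε) (hεη : ε ≤ η)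
    (hd : ∀ z : ℂ, z.re ≤ b → ε ≤ |z.im| → |z.im| ≤ η → DifferentiableAt ℂ f z)
    (hb : Continuous fun y : ℝ => f (b + y * Complex.I))
    (h₁ : HankelIntegrable f b ε) (h₂ : HankelIntegrable f b η)
    (hC : ∀ᶠ x : ℝ in atBot, ∀ y : ℝ, |y| ≤ η → ‖f (x + y * Complex.I)‖ ≤ C * Real.exp (a * x)) :
    hankelIntegral f b η = hankelIntegral f b ε := by
  have e1 := integral_Iic_rect_eq_zero (f := f) (b := b) (y₁ := ε) (y₂ := η) (C := C) ha
    (fun z hz => by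
      rw [Complex.mem_reProdIm, Set.uIcc_of_le hεη] at hz
      have := abs_of_pos (hε.trans_le hz.2.1)
      exact (hd z hz.1 (by linarith [hz.2.1]) (by linarith [hz.2.2])).differentiableWithinAt)
    h₁.2.2 h₂.2.2
    (by
      filter_upwards [hC] with x hx y hy
      rw [Set.uIcc_of_le hεη] at hy
      exact hx y (by rw [abs_of_pos (hε.trans_le hy.1)]; exact hy.2))
  have e2 := integral_Iic_rect_eq_zero (f := f) (b := b) (y₁ := -η) (y₂ := -ε) (C := C) ha
    (fun z hz => by
      rw [Complex.mem_reProdIm, Set.uIcc_of_le (neg_le_neg hεη)] at hz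
      have := abs_of_neg (show z.im < 0 by linarith [hz.2.2])
      exact (hd z hz.1 (by linarith [hz.2.2]) (by linarith [hz.2.1])).differentiableWithinAt)
    (by simpa [sub_eq_add_neg] using h₂.1) (by simpa [sub_eq_add_neg] using h₁.1)
    (by
      filter_upwards [hC] with x hx y hy
      rw [Set.uIcc_of_le (neg_le_neg hεη)] at hy
      exact hx y (by rw [abs_of_neg (show y < 0 by linarith [hy.2])]; linarith [hy.1]))
  have i : ∀ y₁ y₂, IntervalIntegrable (fun y : ℝ => f (b + y * Complex.I)) volume y₁ y₂ :=
    fun y₁ y₂ => hb.intervalIntegrable _ _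
  have e3 := intervalIntegral.integral_add_adjacent_intervals (i (-η) (-ε)) (i (-ε) ε)
  have e4 := intervalIntegral.integral_add_adjacent_intervals (i (-η) ε) (i ε η)
  unfold hankelIntegral
  rw [← e4, ← e3]
  push_cast [sub_eq_add_neg] at e1 e2 ⊢
  simp only [neg_mul] at e1 e2 ⊢
  linear_combination e2 + e1

section Kernel

variable {c : ℝ} {u : ℂ} {m b η : ℝ}

theorem hasDerivAt_hankelKernel {z : ℂ} (h : 1 - m * Complex.exp (-z) ∈ Complex.slitPlane) :
    HasDerivAt (hankelKernel c u m)
      ((u + c) * hankelKernel c u m z - c * hankelKernel (c + 1) u m z) z := by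
  have h0 : 1 - (m : ℂ) * Complex.exp (-z) ≠ 0 := Complex.slitPlane_ne_zero h
  have h1 : HasDerivAt (fun z : ℂ => 1 - m * Complex.exp (-z)) (m * Complex.exp (-z)) z := by
    simpa using (((hasDerivAt_neg z).cexp).const_mul (m : ℂ)).const_sub 1
  have h2 := (((hasDerivAt_id z).const_mul u).sub ((h1.clog h).const_mul (c : ℂ))).cexp
  have h3 : hankelKernel (c + 1) u m z
      = hankelKernel c u m z / (1 - m * Complex.exp (-z)) := by
    unfold hankelKernel
    rw [div_eq_mul_inv]
    conv_rhs => rw [← Complex.exp_log h0, ← Complex.exp_neg, Complex.exp_log h0, ← Complex.exp_add]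
    push_cast
    ring_nf
  refine h2.congr_deriv ?_
  rw [h3]
  simp only [hankelKernel, id, Pi.sub_apply]
  field_simp
  ring

theorem differentiableAt_hankelKernel {z : ℂ}
    (h : 1 - m * Complex.exp (-z) ∈ Complex.slitPlane) :
    DifferentiableAt ℂ (hankelKernel c u m) z := (hasDerivAt_hankelKernel h).differentiableAt

theorem hankelIntegrable_hankelKernel (hc : 0 ≤ c) (hu : 0 < u.re) {R : ℝ} (hR : 0 < R)
    (hm : m ∈ Set.Icc 0 R) (hb : Real.log R < b) (h0 : 0 < η) (h2 : η < 2 * Real.pi) :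
    HankelIntegrable (hankelKernel c u m) b η :=
  hankelIntegrable_iff.2 ⟨(isHankelPath_lower R b h0 h2).integrable_hankelKernel hc hu hm,
    (isHankelPath_vertical hR hb η).integrable_hankelKernel hc hu hm,
    (isHankelPath_upper R b h0 h2).integrable_hankelKernel hc hu hm⟩

theorem tendsto_hankelKernel_horizontal (hc : 0 ≤ c) (hu : 0 < u.re) (hm : 0 ≤ m) {y : ℝ}
    (hy : 0 < |y| ∧ |y| < 2 * Real.pi) :
    Tendsto (fun t : ℝ => hankelKernel c u m (t + y * Complex.I)) atBot (𝓝 0) := by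
  obtain ⟨δ, hδ, h⟩ := exists_le_norm_one_sub_mul_exp_neg hy
  refine squeeze_zero_norm
    (a := fun t : ℝ => δ ^ (-c) * Real.exp (|u.im| * |y|) * Real.exp (u.re * t)) (fun t => ?_) ?_
  · have := norm_hankelKernel_le (c := c) (u := u) (B := |y|) hc hδ
      (h m hm (t + y * Complex.I) (by simp)) (by simp)
    simpa using this
  · have : Tendsto (fun T : ℝ => Real.exp (u.re * T)) atBot (𝓝 0) :=
      Real.tendsto_exp_atBot.comp (tendsto_id.const_mul_atBot hu)
    simpa using this.const_mul (δ ^ (-c) * Real.exp (|u.im| * |y|))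

theorem hankelIntegral_hankelKernel_add_one (hc : 0 ≤ c) (hu : 0 < u.re) {R : ℝ} (hR : 0 < R)
    (hm : m ∈ Set.Icc 0 R) (hb : Real.log R < b) (h0 : 0 < η) (h2 : η < 2 * Real.pi) :
    (u + c) * hankelIntegral (hankelKernel c u m) b η
      = c * hankelIntegral (hankelKernel (c + 1) u m) b η := by
  have i1 := hankelIntegrable_hankelKernel hc hu hR hm hb h0 h2
  have i2 := hankelIntegrable_hankelKernel (c := c + 1) (by linarith) hu hR hm hb h0 h2
  have i1' : HankelIntegrable (fun z => (u + c) * hankelKernel c u m z) b η :=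
    ⟨i1.1.const_mul _, i1.2.1.const_mul _, i1.2.2.const_mul _⟩
  have i2' : HankelIntegrable (fun z => c * hankelKernel (c + 1) u m z) b η :=
    ⟨i2.1.const_mul _, i2.2.1.const_mul _, i2.2.2.const_mul _⟩
  have hy := abs_neg_and h0 h2
  have key := hankelIntegral_deriv_eq_zero (b := b) (η := η) (G := hankelKernel c u m)
    (f := fun z => (u + c) * hankelKernel c u m z - c * hankelKernel (c + 1) u m z)
    (fun t _ => hasDerivAt_hankelKernel
      (one_sub_mul_exp_neg_mem_slitPlane hm.1 (Or.inr (by simpa using hy.1))))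
    (fun y => hasDerivAt_hankelKernel
      (one_sub_mul_exp_neg_mem_slitPlane hm.1 (Or.inl (by
        have := mul_le_mul_of_nonneg_right hm.2 (Real.exp_pos (-b)).le
        simpa using this.trans_lt (mul_exp_neg_lt_one hR hb)))))
    (fun t _ => hasDerivAt_hankelKernel
      (one_sub_mul_exp_neg_mem_slitPlane hm.1 (Or.inr (by simpa using hy.1))))
    ⟨i1'.1.sub i2'.1, i1'.2.1.sub i2'.2.1, i1'.2.2.sub i2'.2.2⟩
    (by simpa [sub_eq_add_neg] using tendsto_hankelKernel_horizontal (c := c) hc hu hm.1 hy.2)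
    (tendsto_hankelKernel_horizontal hc hu hm.1 hy.1)
  rw [hankelIntegral_sub i1' i2', hankelIntegral_const_mul, hankelIntegral_const_mul] at key
  exact sub_eq_zero.1 key

theorem continuousAt_hankelIntegral_hankelKernel (hc : 0 < c) (hu : 0 < u.re) {R : ℝ} (hR : 0 < R)
    (hm : m ∈ Set.Icc 0 R) (hb : Real.log R < b) (h0 : 0 < η) (h2 : η < 2 * Real.pi) :
    ContinuousAt (fun c => hankelIntegral (hankelKernel c u m) b η) c := by
  simp_rw [hankelIntegral_eq h0.le]
  exact (((isHankelPath_lower R b h0 h2).continuousAt_integral_hankelKernel hu hm hc).add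
    (((isHankelPath_vertical hR hb η).continuousAt_integral_hankelKernel hu hm hc).const_mul _)).sub
    ((isHankelPath_upper R b h0 h2).continuousAt_integral_hankelKernel hu hm hc)

end Kernel

section Beta

variable {c : ℝ} {u : ℂ}

theorem exp_image_Iio_zero : Real.exp '' Set.Iio 0 = Set.Ioo 0 1 := by
  ext x
  constructor
  · rintro ⟨t, ht, rfl⟩
    exact ⟨Real.exp_pos t, Real.exp_lt_one_iff.2 ht⟩
  · intro hx
    exact ⟨Real.log x, Real.log_neg hx.1 hx.2, Real.exp_log hx.1⟩

theorem abs_exp_smul_beta {t : ℝ} (ht : t ∈ Set.Iio 0) :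
    |Real.exp t| • (((Real.exp t : ℝ) : ℂ) ^ (u + c - 1) * (1 - (Real.exp t : ℝ)) ^ ((1 - c : ℂ) - 1))
      = Complex.exp (u * t) * (|1 - Real.exp (-t)| ^ (-c) : ℝ) := by
  have ht : t < 0 := ht
  have h1 : 0 < 1 - Real.exp t := by linarith [Real.exp_lt_one_iff.2 ht]
  have h2 : |1 - Real.exp (-t)| = Real.exp (-t) * (1 - Real.exp t) := by
    have : 1 < Real.exp (-t) := Real.one_lt_exp_iff.2 (by linarith)
    rw [abs_of_neg (by linarith), mul_sub, ← Real.exp_add]; simp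
  have h3 : (1 - (Real.exp t : ℝ) : ℂ) ^ ((1 - c : ℂ) - 1) = ((1 - Real.exp t) ^ (-c) : ℝ) := by
    rw [Complex.ofReal_cpow h1.le]; push_cast; ring_nf
  have h4 : ((Real.exp t : ℝ) : ℂ) ^ (u + c - 1) = Complex.exp (t * (u + c - 1)) := by
    rw [Complex.cpow_def_of_ne_zero (by exact_mod_cast (Real.exp_pos t).ne'), ← Complex.ofReal_log
      (Real.exp_pos t).le, Real.log_exp]
  rw [h2, h3, h4, Real.mul_rpow (Real.exp_pos _).le h1.le, ← Real.exp_mul, abs_of_pos (Real.exp_pos _),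
    Complex.real_smul]
  push_cast
  rw [← mul_assoc, ← mul_assoc, ← Complex.exp_add, ← Complex.exp_add]
  ring_nf

theorem integrableOn_Iio_beta (hc : 0 < c) (hc1 : c < 1) (hu : 0 < u.re) :
    IntegrableOn (fun t : ℝ => Complex.exp (u * t) * (|1 - Real.exp (-t)| ^ (-c) : ℝ))
      (Set.Iio 0) := by
  have h := Complex.betaIntegral_convergent (u := u + c) (v := 1 - c)
    (by simp; linarith) (by simpa using hc1)
  rw [intervalIntegrable_iff_integrableOn_Ioo_of_le zero_le_one, ← exp_image_Iio_zero,
    integrableOn_image_iff_integrableOn_abs_deriv_smul measurableSet_Iio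
      (fun x _ => (Real.hasDerivAt_exp x).hasDerivWithinAt) Real.exp_injective.injOn] at h
  exact h.congr_fun (fun t ht => abs_exp_smul_beta ht) measurableSet_Iio

theorem integral_Iio_beta :
    ∫ t in Set.Iio (0 : ℝ), Complex.exp (u * t) * (|1 - Real.exp (-t)| ^ (-c) : ℝ)
      = Complex.betaIntegral (u + c) (1 - c) := by
  rw [Complex.betaIntegral, intervalIntegral.integral_of_le zero_le_one,
    integral_Ioc_eq_integral_Ioo, ← exp_image_Iio_zero,
    integral_image_eq_integral_abs_deriv_smul measurableSet_Iio
      (fun x _ => (Real.hasDerivAt_exp x).hasDerivWithinAt) Real.exp_injective.injOn]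
  exact (setIntegral_congr_fun measurableSet_Iio fun t ht => abs_exp_smul_beta ht).symm

theorem integrableOn_Iic_beta (hc : 0 < c) (hc1 : c < 1) (hu : 0 < u.re) (b : ℝ) :
    IntegrableOn (fun t : ℝ => Complex.exp (u * t) * (|1 - Real.exp (-t)| ^ (-c) : ℝ))
      (Set.Iic b) := by
  rcases le_or_gt b 0 with hb | hb
  · exact IntegrableOn.congr_set_ae ((integrableOn_Iio_beta hc hc1 hu).mono_set
      (Set.Iio_subset_Iio hb)) Iio_ae_eq_Iic.symm
  have hI : Set.Iic b = Set.Iic 0 ∪ Set.Ioc 0 b := (Set.Iic_union_Ioc_eq_Iic hb.le).symm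
  rw [hI]
  refine IntegrableOn.union ((integrableOn_Iio_beta hc hc1 hu).congr_set_ae Iio_ae_eq_Iic.symm) ?_
  have hi : IntegrableOn
      (fun t : ℝ => Real.exp (u.re * b) * (Real.exp (-b) ^ (-c) * t ^ (-c))) (Set.Ioc 0 b) := by
    rw [integrableOn_Ioc_iff_integrableOn_Ioo]
    exact (((intervalIntegral.integrableOn_Ioo_rpow_iff hb).2 (by linarith)).const_mul _).const_mul _
  refine Integrable.mono' hi (Measurable.aestronglyMeasurable (by fun_prop)) ?_
  filter_upwards [ae_restrict_mem measurableSet_Ioc] with t ht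
  rw [norm_mul, Complex.norm_exp, Complex.norm_real, Real.norm_of_nonneg (by positivity)]
  have h1 : Real.exp (-b) * t ≤ |1 - Real.exp (-t)| := by
    refine le_trans ?_ (le_abs_self _)
    have h2 : Real.exp (-b) ≤ Real.exp (-t) := Real.exp_le_exp.2 (by linarith [ht.2])
    have h3 : Real.exp (-t) * (t + 1) ≤ Real.exp (-t) * Real.exp t := by
      gcongr; exact Real.add_one_le_exp t
    rw [← Real.exp_add, neg_add_cancel, Real.exp_zero] at h3
    nlinarith [ht.1]
  rw [← Real.mul_rpow (Real.exp_pos _).le ht.1.le]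
  have h4 : |1 - Real.exp (-t)| ^ (-c) ≤ (Real.exp (-b) * t) ^ (-c) :=
    Real.rpow_le_rpow_of_nonpos (mul_pos (Real.exp_pos _) ht.1) h1 (by linarith)
  have h5 : (u * t).re ≤ u.re * b := by
    simpa using mul_le_mul_of_nonneg_left ht.2 hu.le
  gcongr

end Beta

section Limit

variable {c : ℝ} {u : ℂ}

theorem norm_one_sub_exp_neg_ge (z : ℂ) :
    |1 - Real.exp (-z.re)| ≤ ‖1 - ((1 : ℝ) : ℂ) * Complex.exp (-z)‖ := by
  have := abs_norm_sub_norm_le (1 : ℂ) (((1 : ℝ) : ℂ) * Complex.exp (-z))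
  rwa [norm_one, norm_ofReal_mul_exp_neg zero_le_one, one_mul] at this

theorem abs_one_sub_exp_neg_pos {t : ℝ} (ht : t ≠ 0) : 0 < |1 - Real.exp (-t)| := by
  rw [abs_pos, sub_ne_zero, ne_comm, Ne, Real.exp_eq_one_iff]
  simpa using ht

theorem hankelKernel_one_boundary {t : ℝ} (ht : t ≠ 0) (v : ℂ) :
    Complex.exp (u * t - c * ((Real.log |1 - Real.exp (-t)| : ℝ) + v))
      = Complex.exp (u * t) * (|1 - Real.exp (-t)| ^ (-c) : ℝ) * Complex.exp (-(c * v)) := by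
  rw [Real.rpow_def_of_pos (abs_one_sub_exp_neg_pos ht)]
  push_cast
  rw [← Complex.exp_add, ← Complex.exp_add]
  ring_nf

/-- Boundary values of the kernel on the cut. The sign `σ` tells the side. -/
theorem tendsto_hankelKernel_cut {σ : ℝ} (hσ : σ = 1 ∨ σ = -1) {t : ℝ} (ht : t ≠ 0) :
    Tendsto (fun ε : ℝ => hankelKernel c u 1 (t + (σ * ε : ℝ) * Complex.I)) (𝓝[>] 0)
      (𝓝 (Complex.exp (u * t) * (|1 - Real.exp (-t)| ^ (-c) : ℝ) *
        Complex.exp (-(c * (if t < 0 then σ * Real.pi * Complex.I else 0))))) := by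
  rw [← hankelKernel_one_boundary ht]
  unfold hankelKernel
  have hz : Tendsto (fun ε : ℝ => (t : ℂ) + (σ * ε : ℝ) * Complex.I) (𝓝[>] 0) (𝓝 t) := by
    have : Continuous fun ε : ℝ => (t : ℂ) + (σ * ε : ℝ) * Complex.I := by fun_prop
    simpa [ContinuousWithinAt] using this.continuousWithinAt (s := Set.Ioi 0) (x := 0)
  have hv : Tendsto (fun ε : ℝ => 1 - ((1 : ℝ) : ℂ) *
      Complex.exp (-((t : ℂ) + (σ * ε : ℝ) * Complex.I))) (𝓝[>] 0)
      (𝓝 (1 - ((1 : ℝ) : ℂ) * Complex.exp (-(t : ℂ)))) :=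
    tendsto_const_nhds.sub ((((Complex.continuous_exp.tendsto _).comp hz.neg)).const_mul _)
  have hval : (1 - ((1 : ℝ) : ℂ) * Complex.exp (-(t : ℂ))) = ((1 - Real.exp (-t) : ℝ) : ℂ) := by
    push_cast; ring
  suffices h : Tendsto (fun ε : ℝ => Complex.log (1 - ((1 : ℝ) : ℂ) *
      Complex.exp (-((t : ℂ) + (σ * ε : ℝ) * Complex.I)))) (𝓝[>] 0)
      (𝓝 ((Real.log |1 - Real.exp (-t)| : ℝ) +
        (if t < 0 then σ * Real.pi * Complex.I else 0))) from
    (Complex.continuous_exp.tendsto _).comp ((hz.const_mul u).sub (h.const_mul _))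
  split_ifs with h
  · have hneg : 1 - Real.exp (-t) < 0 := by
      have : 1 < Real.exp (-t) := Real.one_lt_exp_iff.2 (by linarith)
      linarith
    have him : ∀ᶠ ε : ℝ in 𝓝[>] 0, 0 < Real.sin ε := by
      filter_upwards [Ioo_mem_nhdsGT Real.pi_pos] with ε hε
      exact Real.sin_pos_of_pos_of_lt_pi hε.1 hε.2
    have hIm : ∀ ε : ℝ, (1 - ((1 : ℝ) : ℂ) *
        Complex.exp (-((t : ℂ) + (σ * ε : ℝ) * Complex.I))).im
        = σ * (Real.exp (-t) * Real.sin ε) := by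
      intro ε
      rw [im_one_sub_mul_exp_neg]
      rcases hσ with rfl | rfl <;> simp
    have hnorm : ‖((1 - Real.exp (-t) : ℝ) : ℂ)‖ = |1 - Real.exp (-t)| := by
      rw [Complex.norm_real, Real.norm_eq_abs]
    rcases hσ with rfl | rfl
    · have := Complex.tendsto_log_nhdsWithin_im_nonneg_of_re_neg_of_im_zero
        (z := ((1 - Real.exp (-t) : ℝ) : ℂ)) hneg (Complex.ofReal_im _)
      rw [hnorm] at this
      simp only [Complex.ofReal_one, one_mul] at hv hval hIm ⊢
      refine this.comp (tendsto_nhdsWithin_iff.2 ⟨hval ▸ hv, ?_⟩)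
      filter_upwards [him] with ε hε
      simp only [hIm]
      positivity
    · have := Complex.tendsto_log_nhdsWithin_im_neg_of_re_neg_of_im_zero
        (z := ((1 - Real.exp (-t) : ℝ) : ℂ)) hneg (Complex.ofReal_im _)
      rw [hnorm] at this
      have e : (Real.log |1 - Real.exp (-t)| : ℂ) - Real.pi * Complex.I
          = (Real.log |1 - Real.exp (-t)| : ℝ) + ((-1 : ℝ) : ℂ) * Real.pi * Complex.I := by
        push_cast; ring
      rw [e] at this
      refine this.comp (tendsto_nhdsWithin_iff.2 ⟨hval ▸ hv, ?_⟩)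
      filter_upwards [him] with ε hε
      simp only [hIm]
      have := mul_pos (Real.exp_pos (-t)) hε
      linarith
  · have hpos : 0 < 1 - Real.exp (-t) := by
      have : Real.exp (-t) < 1 := Real.exp_lt_one_iff.2
        (by have := lt_of_le_of_ne (not_lt.1 h) ht.symm; linarith)
      linarith
    rw [add_zero, abs_of_pos hpos, Complex.ofReal_log hpos.le]
    rw [hval] at hv
    exact hv.clog (Complex.ofReal_mem_slitPlane.2 hpos)

theorem tendsto_integral_hankelKernel_cut (hc : 0 < c) (hc1 : c < 1) (hu : 0 < u.re) (b : ℝ)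
    {σ : ℝ} (hσ : σ = 1 ∨ σ = -1) :
    Tendsto (fun ε : ℝ => ∫ t in Set.Iic b, hankelKernel c u 1 (t + (σ * ε : ℝ) * Complex.I))
      (𝓝[>] 0)
      (𝓝 (∫ t in Set.Iic b, Complex.exp (u * t) * (|1 - Real.exp (-t)| ^ (-c) : ℝ) *
        Complex.exp (-(c * (if t < 0 then σ * Real.pi * Complex.I else 0))))) := by
  refine tendsto_integral_filter_of_dominated_convergence
    (fun t : ℝ => Real.exp (|u.im| * 1) *
      ‖Complex.exp (u * t) * (|1 - Real.exp (-t)| ^ (-c) : ℝ)‖)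
    (Eventually.of_forall fun ε => ?_) ?_
    ((integrableOn_Iic_beta hc hc1 hu b).norm.const_mul _) ?_
  · unfold hankelKernel
    exact Measurable.aestronglyMeasurable (by fun_prop)
  · filter_upwards [Ioo_mem_nhdsGT (zero_lt_one (α := ℝ))] with ε hε
    filter_upwards [compl_mem_ae_iff.2 (measure_singleton (0 : ℝ))] with t ht
    have ht : t ≠ 0 := ht
    have h1 := norm_one_sub_exp_neg_ge ((t : ℂ) + (σ * ε : ℝ) * Complex.I)
    have hre : ((t : ℂ) + (σ * ε : ℝ) * Complex.I).re = t := by simp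
    have him : |((t : ℂ) + (σ * ε : ℝ) * Complex.I).im| ≤ 1 := by
      rcases hσ with rfl | rfl <;> simp [abs_of_pos hε.1, hε.2.le]
    rw [hre] at h1
    refine (norm_hankelKernel_le hc.le (abs_one_sub_exp_neg_pos ht) h1 him).trans ?_
    rw [hre, norm_mul, Complex.norm_exp, Complex.norm_real, Real.norm_of_nonneg (by positivity)]
    apply le_of_eq
    simp
    ring
  · filter_upwards [ae_restrict_of_ae (compl_mem_ae_iff.2 (measure_singleton (0 : ℝ)))] with t ht
    exact tendsto_hankelKernel_cut hσ ht

theorem continuous_hankelKernel_vertical {b : ℝ} (hb : 0 < b) :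
    Continuous fun y : ℝ => hankelKernel c u 1 (b + y * Complex.I) := by
  refine continuous_iff_continuousAt.2 fun y => ?_
  have h : 1 - ((1 : ℝ) : ℂ) * Complex.exp (-(b + y * Complex.I)) ∈ Complex.slitPlane :=
    one_sub_mul_exp_neg_mem_slitPlane zero_le_one (Or.inl (by simpa using hb))
  exact ContinuousAt.comp (f := fun y : ℝ => (b : ℂ) + y * Complex.I)
    (differentiableAt_hankelKernel h).continuousAt (by fun_prop)

theorem hankelIntegral_one_eq_of_le (hc : 0 ≤ c) (hu : 0 < u.re) {b ε η : ℝ} (hb : 0 < b)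
    (hε : 0 < ε) (hεη : ε ≤ η) (hη : η < 2 * Real.pi) :
    hankelIntegral (hankelKernel c u 1) b η = hankelIntegral (hankelKernel c u 1) b ε := by
  have hm : (1 : ℝ) ∈ Set.Icc (0 : ℝ) 1 := ⟨zero_le_one, le_rfl⟩
  have hb' : Real.log 1 < b := by simpa using hb
  refine hankelIntegral_eq_of_le (C := 1 ^ (-c) * Real.exp (|u.im| * (2 * Real.pi))) hu hε hεη
    (fun z _ h1 h2 => differentiableAt_hankelKernel
      (one_sub_mul_exp_neg_mem_slitPlane zero_le_one (Or.inr ⟨by linarith, by linarith⟩)))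
    (continuous_hankelKernel_vertical hb)
    (hankelIntegrable_hankelKernel hc hu one_pos hm hb' hε (by linarith))
    (hankelIntegrable_hankelKernel hc hu one_pos hm hb' (by linarith) hη) ?_
  filter_upwards [eventually_le_atBot (-1)] with x hx y hy
  have h1 := norm_one_sub_exp_neg_ge ((x : ℂ) + y * Complex.I)
  have hre : ((x : ℂ) + y * Complex.I).re = x := by simp
  rw [hre] at h1
  have h2 : 1 ≤ |1 - Real.exp (-x)| := by
    refine le_trans ?_ (neg_le_abs _)
    linarith [Real.add_one_le_exp (-x)]
  have := norm_hankelKernel_le (c := c) (u := u) (B := 2 * Real.pi) hc one_pos (h2.trans h1)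
    (by simp; linarith)
  rwa [hre] at this

theorem hankelIntegral_one_of_lt_one (hc : 0 < c) (hc1 : c < 1) (hu : 0 < u.re) {b η : ℝ}
    (hb : 0 < b) (h0 : 0 < η) (h2 : η < 2 * Real.pi) :
    hankelIntegral (hankelKernel c u 1) b η
      = 2 * Complex.I * Complex.sin (Real.pi * c) * Complex.betaIntegral (u + c) (1 - c) := by
  have hlow := tendsto_integral_hankelKernel_cut hc hc1 hu b (σ := -1) (Or.inr rfl)
  have hup := tendsto_integral_hankelKernel_cut hc hc1 hu b (σ := 1) (Or.inl rfl)
  have hcont := continuous_hankelKernel_vertical (c := c) (u := u) hb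
  have hvert : Tendsto (fun ε : ℝ => ∫ y in (-ε)..ε, hankelKernel c u 1 (b + y * Complex.I))
      (𝓝[>] 0) (𝓝 0) := by
    have hp := intervalIntegral.continuous_primitive
      (fun a b => hcont.intervalIntegrable (μ := volume) a b) 0
    have : Continuous fun ε : ℝ => ∫ y in (-ε)..ε, hankelKernel c u 1 (b + y * Complex.I) := by
      have e : ∀ ε : ℝ, ∫ y in (-ε)..ε, hankelKernel c u 1 (b + y * Complex.I)
          = (∫ y in (0)..ε, hankelKernel c u 1 (b + y * Complex.I))
            - ∫ y in (0)..(-ε), hankelKernel c u 1 (b + y * Complex.I) := fun ε =>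
        (intervalIntegral.integral_interval_sub_left (hcont.intervalIntegrable _ _)
          (hcont.intervalIntegrable _ _)).symm
      simp_rw [e]
      exact hp.sub (hp.comp continuous_neg)
    simpa [ContinuousWithinAt] using this.continuousWithinAt (s := Set.Ioi 0) (x := 0)
  have hlim : Tendsto (fun ε : ℝ => hankelIntegral (hankelKernel c u 1) b ε) (𝓝[>] 0) _ :=
    ((hlow.add (hvert.const_mul Complex.I)).sub hup).congr fun ε => by
      simp only [hankelIntegral, sub_eq_add_neg]
      push_cast
      simp only [neg_mul, one_mul]
  have hconst : Tendsto (fun ε : ℝ => hankelIntegral (hankelKernel c u 1) b ε) (𝓝[>] 0)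
      (𝓝 (hankelIntegral (hankelKernel c u 1) b η)) := by
    refine tendsto_const_nhds.congr' ?_
    filter_upwards [Ioo_mem_nhdsGT h0] with ε hε
    exact hankelIntegral_one_eq_of_le hc.le hu hb hε.1 hε.2.le h2
  rw [tendsto_nhds_unique hconst hlim, mul_zero, add_zero]
  have hi : ∀ σ : ℝ, IntegrableOn (fun t : ℝ => Complex.exp (u * t) *
      (|1 - Real.exp (-t)| ^ (-c) : ℝ) *
        Complex.exp (-(c * (if t < 0 then σ * Real.pi * Complex.I else 0)))) (Set.Iic b) := by
    intro σ
    refine (integrableOn_Iic_beta hc hc1 hu b).mul_bdd (c := 1)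
      (Measurable.aestronglyMeasurable (by
        refine Complex.measurable_exp.comp (Measurable.neg (Measurable.const_mul ?_ _))
        exact Measurable.ite measurableSet_Iio measurable_const measurable_const))
      (ae_of_all _ fun t => ?_)
    rw [Complex.norm_exp]
    split_ifs <;> simp
  rw [← integral_sub (hi _) (hi _), ← integral_Iio_beta, ← integral_const_mul]
  have hsin : Complex.exp (-(c * (((-1 : ℝ) : ℂ) * Real.pi * Complex.I)))
      - Complex.exp (-(c * (((1 : ℝ) : ℂ) * Real.pi * Complex.I)))
      = 2 * Complex.I * Complex.sin (Real.pi * c) := by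
    rw [Complex.sin]
    have e1 : -(c * (((-1 : ℝ) : ℂ) * Real.pi * Complex.I)) = Real.pi * c * Complex.I := by
      push_cast; ring
    have e2 : -(c * (((1 : ℝ) : ℂ) * Real.pi * Complex.I)) = -(Real.pi * c) * Complex.I := by
      push_cast; ring
    rw [e1, e2]
    linear_combination (Complex.exp (Real.pi * c * Complex.I)
      - Complex.exp (-(Real.pi * c) * Complex.I)) * Complex.I_sq
  have hae : ∀ t : ℝ, Complex.exp (u * t) * (|1 - Real.exp (-t)| ^ (-c) : ℝ) *
        Complex.exp (-(c * (if t < 0 then ((-1 : ℝ) : ℂ) * Real.pi * Complex.I else 0)))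
      - Complex.exp (u * t) * (|1 - Real.exp (-t)| ^ (-c) : ℝ) *
        Complex.exp (-(c * (if t < 0 then ((1 : ℝ) : ℂ) * Real.pi * Complex.I else 0)))
      = (Set.Iio 0).indicator (fun t : ℝ => 2 * Complex.I * Complex.sin (Real.pi * c) *
        (Complex.exp (u * t) * (|1 - Real.exp (-t)| ^ (-c) : ℝ))) t := by
    intro t
    by_cases ht : t < 0
    · rw [Set.indicator_of_mem (show t ∈ Set.Iio 0 from ht), if_pos ht, if_pos ht, ← mul_sub, hsin]
      ring
    · rw [Set.indicator_of_notMem (show t ∉ Set.Iio 0 from ht), if_neg ht, if_neg ht]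
      ring
  simp_rw [hae]
  rw [setIntegral_indicator measurableSet_Iio]
  congr 2
  exact Set.inter_eq_right.2 fun t ht => Set.mem_Iic.2 ((Set.mem_Iio.1 ht).le.trans hb.le)

theorem hankelIntegral_one (hc : 0 < c) (hu : 0 < u.re) {b η : ℝ}
    (hb : 0 < b) (h0 : 0 < η) (h2 : η < 2 * Real.pi) :
    hankelIntegral (hankelKernel c u 1) b η * (Complex.Gamma c * Complex.Gamma (u + 1))
      = 2 * Real.pi * Complex.I * Complex.Gamma (u + c) := by
  have hm : (1 : ℝ) ∈ Set.Icc (0 : ℝ) 1 := ⟨zero_le_one, le_rfl⟩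
  have hb' : Real.log 1 < b := by simpa using hb
  have small : ∀ c : ℝ, 0 < c → c < 1 →
      hankelIntegral (hankelKernel c u 1) b η * (Complex.Gamma c * Complex.Gamma (u + 1))
      = 2 * Real.pi * Complex.I * Complex.Gamma (u + c) := by
    intro c hc hc1
    rw [hankelIntegral_one_of_lt_one hc hc1 hu hb h0 h2]
    have hB := Complex.Gamma_mul_Gamma_eq_betaIntegral (s := u + c) (t := 1 - c)
      (by simp; linarith) (by simpa using hc1)
    rw [show u + c + (1 - c) = u + 1 by ring] at hB
    have hR := Complex.Gamma_mul_Gamma_one_sub (c : ℂ)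
    have hs : Complex.sin (Real.pi * c) ≠ 0 := by
      rw [← Complex.ofReal_mul, ← Complex.ofReal_sin]
      exact_mod_cast (Real.sin_pos_of_pos_of_lt_pi (by positivity)
        (by nlinarith [Real.pi_pos])).ne'
    rw [eq_div_iff hs] at hR
    linear_combination (-2 * Complex.I * Complex.sin (Real.pi * c) * Complex.Gamma c) * hB
      + 2 * Complex.I * Complex.Gamma (u + c) * hR
  have step : ∀ c : ℝ, 0 < c →
      hankelIntegral (hankelKernel c u 1) b η * (Complex.Gamma c * Complex.Gamma (u + 1))
        = 2 * Real.pi * Complex.I * Complex.Gamma (u + c) →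
      hankelIntegral (hankelKernel (c + 1) u 1) b η *
          (Complex.Gamma ((c + 1 : ℝ) : ℂ) * Complex.Gamma (u + 1))
        = 2 * Real.pi * Complex.I * Complex.Gamma (u + ((c + 1 : ℝ) : ℂ)) := by
    intro c hc h
    have hrec := hankelIntegral_hankelKernel_add_one hc.le hu one_pos hm hb' h0 h2
    have hcz : (c : ℂ) ≠ 0 := by exact_mod_cast hc.ne'
    have huc : u + c ≠ 0 := by
      intro h
      have := congrArg Complex.re h
      simp at this
      linarith
    push_cast
    rw [Complex.Gamma_add_one _ hcz, ← add_assoc, Complex.Gamma_add_one _ huc]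
    linear_combination (-(Complex.Gamma c * Complex.Gamma (u + 1))) * hrec + (u + c) * h
  have at_one : hankelIntegral (hankelKernel 1 u 1) b η *
      (Complex.Gamma ((1 : ℝ) : ℂ) * Complex.Gamma (u + 1))
      = 2 * Real.pi * Complex.I * Complex.Gamma (u + ((1 : ℝ) : ℂ)) := by
    have hG : ∀ s : ℂ, 0 < s.re → ContinuousAt Complex.Gamma s := fun s hs =>
      (Complex.differentiableAt_Gamma s fun n h => by
        rw [h] at hs; simp at hs; linarith [(Nat.cast_nonneg n : (0 : ℝ) ≤ n)]).continuousAt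
    have cG1 : ContinuousAt (fun c : ℝ => Complex.Gamma (c : ℂ)) 1 :=
      ContinuousAt.comp (f := fun c : ℝ => (c : ℂ)) (hG _ (by simp)) (by fun_prop)
    have cG2 : ContinuousAt (fun c : ℝ => Complex.Gamma (u + c)) 1 :=
      ContinuousAt.comp (f := fun c : ℝ => u + (c : ℂ)) (hG _ (by simp; linarith)) (by fun_prop)
    have cL := (continuousAt_hankelIntegral_hankelKernel one_pos hu one_pos hm hb' h0 h2).mul
      (cG1.mul_const (Complex.Gamma (u + 1)))
    have cR := cG2.const_mul (2 * Real.pi * Complex.I)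
    refine tendsto_nhds_unique (l := 𝓝[<] (1 : ℝ)) (cL.tendsto.mono_left nhdsWithin_le_nhds)
      ((cR.tendsto.mono_left nhdsWithin_le_nhds).congr' ?_)
    filter_upwards [Ioo_mem_nhdsLT (zero_lt_one (α := ℝ))] with c hc
    exact (small c hc.1 hc.2).symm
  have all : ∀ n : ℕ, ∀ c : ℝ, 0 < c → c ≤ n + 1 →
      hankelIntegral (hankelKernel c u 1) b η * (Complex.Gamma c * Complex.Gamma (u + 1))
      = 2 * Real.pi * Complex.I * Complex.Gamma (u + c) := by
    intro n
    induction n with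
    | zero =>
      intro c hc hc1
      rcases (by simpa using hc1 : c ≤ 1).lt_or_eq with h | rfl
      · exact small c hc h
      · exact at_one
    | succ n ih =>
      intro c hc hc1
      rcases le_or_gt c (n + 1) with h | h
      · exact ih c hc h
      · have hc' : 0 < c - 1 := by linarith [(Nat.cast_nonneg n : (0 : ℝ) ≤ n)]
        have := step (c - 1) hc' (ih (c - 1) hc' (by push_cast at hc1; linarith))
        simpa only [sub_add_cancel] using this
  obtain ⟨n, hn⟩ := exists_nat_ge c
  exact all n c hc (by linarith)

/-- Hankel's formula for a point mass: the loop integral of `e^{uz} (1 - m e^{-z})^{-c}`. -/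
theorem hankelIntegral_hankelKernel (hc : 0 < c) (hu : 0 < u.re) {R m b η : ℝ} (hR : 0 < R)
    (hm : m ∈ Set.Icc 0 R) (hb : Real.log R < b) (h0 : 0 < η) (h2 : η < 2 * Real.pi) :
    Complex.Gamma c * Complex.Gamma (u + 1) / Complex.Gamma (u + c)
      * ((2 * Real.pi * Complex.I)⁻¹ * hankelIntegral (hankelKernel c u m) b η)
      = (m : ℂ) ^ u := by
  rcases hm.1.eq_or_lt with rfl | hm0
  · have hu0 : u ≠ 0 := by rintro rfl; simp at hu
    have hk : ∀ c : ℝ, hankelKernel c u ((0 : ℝ)) = hankelKernel 0 u ((0 : ℝ)) := by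
      intro c; ext z; simp [hankelKernel]
    have := hankelIntegral_hankelKernel_add_one le_rfl hu hR hm hb h0 h2
    rw [hk c]
    simp only [Complex.ofReal_zero, add_zero, zero_mul, mul_eq_zero, hu0, false_or] at this ⊢
    rw [this, Complex.zero_cpow hu0]
    simp
  · have hlog : Real.log m ≤ Real.log R := Real.log_le_log hm0 hm.2
    have hmz : (m : ℂ) ≠ 0 := by exact_mod_cast hm0.ne'
    have hshift : ∀ z : ℂ, hankelKernel c u m (z + Real.log m)
        = (m : ℂ) ^ u * hankelKernel c u 1 z := by
      intro z
      have : (m : ℂ) * Complex.exp (-(z + Real.log m)) = ((1 : ℝ) : ℂ) * Complex.exp (-z) := by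
        rw [neg_add, Complex.exp_add, ← Complex.ofReal_neg, ← Complex.ofReal_exp, Real.exp_neg,
          Real.exp_log hm0]
        push_cast
        field_simp
      rw [hankelKernel, this, hankelKernel, Complex.cpow_def_of_ne_zero hmz, ← Complex.exp_add,
        Complex.ofReal_log hm0.le]
      ring_nf
    rw [← hankelIntegral_comp_add (Real.log m)]
    simp_rw [hshift]
    rw [hankelIntegral_const_mul]
    have key := hankelIntegral_one (u := u) hc hu (b := b - Real.log m) (by linarith) h0 h2
    have hG : Complex.Gamma (u + c) ≠ 0 :=
      Complex.Gamma_ne_zero_of_re_pos (by simp; linarith)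
    have hpi : (2 * Real.pi * Complex.I : ℂ) ≠ 0 := Complex.two_pi_I_ne_zero
    rw [div_mul_eq_mul_div, div_eq_iff hG, inv_mul_eq_div, mul_div_assoc', div_eq_iff hpi]
    linear_combination (m : ℂ) ^ u * key

end Limit

/-! ### The Mellin transform of a compactly supported random mean -/

section Analytic

variable {R : ℝ} {μ ν : Measure ℝ}

theorem one_sub_mul_mem_slitPlane {w : ℂ} (hw : 1 - (R : ℂ) * w ∈ Complex.slitPlane)
    {s : ℝ} (hs : s ∈ Set.Icc 0 R) : 1 - (s : ℂ) * w ∈ Complex.slitPlane := by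
  rw [Complex.mem_slitPlane_iff] at hw ⊢
  simp only [Complex.sub_re, Complex.one_re, Complex.mul_re, Complex.ofReal_re, Complex.ofReal_im,
    zero_mul, sub_zero, Complex.sub_im, Complex.one_im, Complex.mul_im, add_zero, zero_sub,
    neg_ne_zero, mul_ne_zero_iff] at hw ⊢
  by_cases h0 : s = 0
  · left; simp [h0]
  rcases hw with hw | hw
  · left
    rcases le_or_gt w.re 0 with h | h
    · nlinarith [hs.1]
    · nlinarith [mul_le_mul_of_nonneg_right hs.2 h.le]
  · exact Or.inr ⟨h0, hw.2⟩

theorem isOpen_setOf_one_sub_mul_mem_slitPlane (R : ℝ) :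
    IsOpen {w : ℂ | 1 - (R : ℂ) * w ∈ Complex.slitPlane} :=
  Complex.isOpen_slitPlane.preimage (by fun_prop : Continuous fun w : ℂ => 1 - (R : ℂ) * w)

theorem isPreconnected_setOf_one_sub_mul_mem_slitPlane (hR : 0 < R) :
    IsPreconnected {w : ℂ | 1 - (R : ℂ) * w ∈ Complex.slitPlane} := by
  have hstar : StarConvex ℝ 0 {w : ℂ | 1 - (R : ℂ) * w ∈ Complex.slitPlane} := by
    intro w hw a b ha hb hab
    have := one_sub_mul_mem_slitPlane hw (s := b * R)
      ⟨by positivity, by nlinarith⟩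
    simp only [smul_zero, zero_add, Complex.real_smul]
    show 1 - (R : ℂ) * (b * w) ∈ Complex.slitPlane
    convert this using 2
    push_cast; ring
  exact (hstar.isPathConnected (by simp)).isConnected.isPreconnected

theorem differentiableOn_integral_one_sub_mul [IsFiniteMeasure μ]
    (hμ : ∀ᵐ s ∂μ, s ∈ Set.Icc 0 R) {g : ℂ → ℂ} (hgm : Measurable g)
    (hg : DifferentiableOn ℂ g Complex.slitPlane) :
    DifferentiableOn ℂ (fun w : ℂ => ∫ s : ℝ, g (1 - s * w) ∂μ)
      {w : ℂ | 1 - (R : ℂ) * w ∈ Complex.slitPlane} := by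
  intro w₀ hw₀
  obtain ⟨ε, hε, hball⟩ := Metric.nhds_basis_closedBall.mem_iff.1
    ((isOpen_setOf_one_sub_mul_mem_slitPlane R).mem_nhds hw₀)
  have hK : IsCompact ((fun q : ℂ × ℝ => 1 - (q.2 : ℂ) * q.1) ''
      (Metric.closedBall w₀ ε ×ˢ Set.Icc 0 R)) :=
    ((isCompact_closedBall w₀ ε).prod isCompact_Icc).image (by fun_prop)
  have hKs : (fun q : ℂ × ℝ => 1 - (q.2 : ℂ) * q.1) '' (Metric.closedBall w₀ ε ×ˢ Set.Icc 0 R)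
      ⊆ Complex.slitPlane := by
    rintro _ ⟨⟨w, s⟩, ⟨hw, hs⟩, rfl⟩
    exact one_sub_mul_mem_slitPlane (hball hw) hs
  obtain ⟨C, hC⟩ := hK.exists_bound_of_continuousOn (hg.continuousOn.mono hKs)
  obtain ⟨C', hC'⟩ := hK.exists_bound_of_continuousOn
    (((hg.deriv Complex.isOpen_slitPlane).continuousOn).mono hKs)
  have hdm := measurable_deriv g
  refine (hasDerivAt_integral_of_dominated_loc_of_deriv_le (μ := μ) (𝕜 := ℂ)
    (F := fun w s => g (1 - s * w)) (F' := fun w s => deriv g (1 - s * w) * -s)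
    (bound := fun _ => C' * R) (x₀ := w₀)
    (Metric.closedBall_mem_nhds w₀ hε) (Eventually.of_forall fun w => ?_) ?_ ?_ ?_
    (integrable_const _) ?_).2.differentiableAt.differentiableWithinAt
  · exact Measurable.aestronglyMeasurable (by fun_prop)
  · refine Integrable.of_bound (Measurable.aestronglyMeasurable (by fun_prop)) C ?_
    filter_upwards [hμ] with s hs
    exact hC _ ⟨(w₀, s), ⟨Metric.mem_closedBall_self hε.le, hs⟩, rfl⟩
  · exact Measurable.aestronglyMeasurable (by fun_prop)
  · filter_upwards [hμ] with s hs w hw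
    have h1 := hC' _ ⟨(w, s), ⟨hw, hs⟩, rfl⟩
    rw [norm_mul, norm_neg, Complex.norm_real, Real.norm_of_nonneg hs.1]
    exact mul_le_mul h1 hs.2 hs.1 ((norm_nonneg _).trans h1)
  · filter_upwards [hμ] with s hs w hw
    have h1 := one_sub_mul_mem_slitPlane (hball hw) hs
    have h2 : HasDerivAt g (deriv g (1 - s * w)) (1 - s * w) :=
      (hg.differentiableAt (Complex.isOpen_slitPlane.mem_nhds h1)).hasDerivAt
    have h3 : HasDerivAt (fun w : ℂ => 1 - (s : ℂ) * w) (-s) w := by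
      simpa using ((hasDerivAt_id w).const_mul (s : ℂ)).const_sub 1
    exact h2.comp w h3

/-- The Markov–Krein identity extends from the negative half-line to the cut plane. -/
theorem markovKrein_complex [IsFiniteMeasure μ] [IsFiniteMeasure ν] {c : ℝ} (hR : 0 < R)
    (hμ : ∀ᵐ s ∂μ, s ∈ Set.Icc 0 R) (hν : ∀ᵐ s ∂ν, s ∈ Set.Icc 0 R)
    (hMK : ∀ t : ℝ, 0 ≤ t →
      ∫ s, (1 + t * s) ^ (-c) ∂μ = Real.exp (-c * ∫ s, Real.log (1 + t * s) ∂ν))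
    {w : ℂ} (hw : 1 - (R : ℂ) * w ∈ Complex.slitPlane) :
    ∫ s : ℝ, Complex.exp (-(c * Complex.log (1 - s * w))) ∂μ
      = Complex.exp (-(c * ∫ s : ℝ, Complex.log (1 - s * w) ∂ν)) := by
  have hopen := isOpen_setOf_one_sub_mul_mem_slitPlane R
  have hlog : DifferentiableOn ℂ Complex.log Complex.slitPlane := fun z hz =>
    (Complex.hasDerivAt_log hz).differentiableAt.differentiableWithinAt
  have d1 := differentiableOn_integral_one_sub_mul (μ := μ) hμ
    (g := fun v => Complex.exp (-(c * Complex.log v)))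
    (by fun_prop) (((hlog.const_mul (c : ℂ)).neg).cexp)
  have d2 : DifferentiableOn ℂ
      (fun w : ℂ => Complex.exp (-(c * ∫ s : ℝ, Complex.log (1 - s * w) ∂ν)))
      {w : ℂ | 1 - (R : ℂ) * w ∈ Complex.slitPlane} := (((differentiableOn_integral_one_sub_mul (μ := ν) hν Complex.measurable_log
    hlog).const_mul (c : ℂ)).neg).cexp
  refine (d1.analyticOnNhd hopen).eqOn_of_preconnected_of_frequently_eq (d2.analyticOnNhd hopen)
    (isPreconnected_setOf_one_sub_mul_mem_slitPlane hR) (z₀ := 0) (by simp) ?_ hw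
  have hseq : Tendsto (fun t : ℝ => (-t : ℂ)) (𝓝[>] 0) (𝓝[≠] 0) := by
    refine tendsto_nhdsWithin_iff.2 ⟨?_, ?_⟩
    · have : Continuous fun t : ℝ => (-t : ℂ) := by fun_prop
      simpa [ContinuousWithinAt] using this.continuousWithinAt (s := Set.Ioi 0) (x := 0)
    · filter_upwards [self_mem_nhdsWithin] with t ht
      have ht : (0 : ℝ) < t := ht
      simpa using ht.ne'
  refine hseq.frequently (Eventually.frequently ?_)
  filter_upwards [self_mem_nhdsWithin] with t ht
  have ht : (0 : ℝ) < t := ht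
  have hval : ∀ s ∈ Set.Icc 0 R, Complex.log (1 - (s : ℂ) * -t) = (Real.log (1 + t * s) : ℝ) := by
    intro s hs
    have : 0 ≤ t * s := mul_nonneg ht.le hs.1
    rw [Complex.ofReal_log (by linarith)]
    push_cast; ring_nf
  have e1 : ∫ s : ℝ, Complex.exp (-(c * Complex.log (1 - s * -t))) ∂μ
      = ∫ s : ℝ, (((1 + t * s) ^ (-c) : ℝ) : ℂ) ∂μ := by
    refine integral_congr_ae ?_
    filter_upwards [hμ] with s hs
    have : 0 ≤ t * s := mul_nonneg ht.le hs.1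
    rw [hval s hs, Real.rpow_def_of_pos (by linarith)]
    push_cast; ring_nf
  have e2 : ∫ s : ℝ, Complex.log (1 - s * -t) ∂ν = ∫ s : ℝ, ((Real.log (1 + t * s) : ℝ) : ℂ) ∂ν := by
    refine integral_congr_ae ?_
    filter_upwards [hν] with s hs using hval s hs
  rw [e1, e2, integral_complex_ofReal, integral_complex_ofReal, hMK t ht.le]
  push_cast; ring_nf

end Analytic

section Fubini

variable {R c : ℝ} {u : ℂ} {μ ν : Measure ℝ} [IsFiniteMeasure μ]

theorem IsHankelPath.integral_hankelKernel_swap {κ : Measure ℝ} [SFinite κ] {p : ℝ → ℂ}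
    (h : IsHankelPath R κ p) (hc : 0 ≤ c) (hu : 0 < u.re) (hμ : ∀ᵐ s ∂μ, s ∈ Set.Icc 0 R)
    {f : ℂ → ℂ} (hf : ∀ᵐ t ∂κ, f (p t) = ∫ s, hankelKernel c u s (p t) ∂μ) :
    Integrable (fun t => f (p t)) κ ∧ Integrable (fun s => ∫ t, hankelKernel c u s (p t) ∂κ) μ ∧
    ∫ t, f (p t) ∂κ = ∫ s, ∫ t, hankelKernel c u s (p t) ∂κ ∂μ := by
  obtain ⟨C, hC⟩ := h.exists_norm_hankelKernel_le u c
  have hp := h.continuous.measurable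
  have hm : AEStronglyMeasurable (fun q : ℝ × ℝ => hankelKernel c u q.2 (p q.1)) (κ.prod μ) := by
    unfold hankelKernel
    exact Measurable.aestronglyMeasurable (by fun_prop)
  have hbound : ∀ᵐ t ∂κ, ∀ᵐ s ∂μ, ‖hankelKernel c u s (p t)‖ ≤ C * Real.exp (u.re * (p t).re) := by
    filter_upwards [hC] with t ht
    filter_upwards [hμ] with s hs using ht c ⟨hc, le_rfl⟩ s hs
  have hi : Integrable (fun q : ℝ × ℝ => hankelKernel c u q.2 (p q.1)) (κ.prod μ) := by
    refine (integrable_prod_iff hm).2 ⟨?_, ?_⟩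
    · filter_upwards [hbound] with t ht
      refine Integrable.of_bound ?_ _ ht
      unfold hankelKernel
      exact Measurable.aestronglyMeasurable (by fun_prop)
    · refine Integrable.mono' (((h.integrable_exp u.re hu).const_mul C).const_mul (μ.real Set.univ))
        hm.norm.integral_prod_right' ?_
      filter_upwards [hbound] with t ht
      rw [Real.norm_of_nonneg (integral_nonneg fun s => norm_nonneg _)]
      calc _ ≤ ∫ _, C * Real.exp (u.re * (p t).re) ∂μ :=
            integral_mono_of_nonneg (ae_of_all _ fun s => norm_nonneg _) (integrable_const _) ht
        _ = _ := by rw [integral_const, smul_eq_mul]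
  refine ⟨hi.integral_prod_left.congr (hf.mono fun t ht => ht.symm), hi.integral_prod_right, ?_⟩
  rw [integral_congr_ae hf]
  exact integral_integral_swap hi

theorem hankelIntegral_integral_hankelKernel (hc : 0 ≤ c) (hu : 0 < u.re) (hR : 0 < R)
    (hμ : ∀ᵐ s ∂μ, s ∈ Set.Icc 0 R) {f : ℂ → ℂ}
    (hf : ∀ z : ℂ, 1 - (R : ℂ) * Complex.exp (-z) ∈ Complex.slitPlane →
      f z = ∫ s, hankelKernel c u s z ∂μ)
    {b η : ℝ} (hb : Real.log R < b) (h0 : 0 < η) (h2 : η < 2 * Real.pi) :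
    HankelIntegrable f b η ∧
      hankelIntegral f b η = ∫ s, hankelIntegral (hankelKernel c u s) b η ∂μ := by
  have hRm : R ∈ Set.Icc 0 R := ⟨hR.le, le_rfl⟩
  have h1 := isHankelPath_lower R b h0 h2
  have h2' := isHankelPath_vertical hR hb η
  have h3 := isHankelPath_upper R b h0 h2
  obtain ⟨i1, j1, e1⟩ := h1.integral_hankelKernel_swap hc hu hμ
    (h1.mem_slitPlane.mono fun t ht => hf _ (ht R hRm))
  obtain ⟨i2, j2, e2⟩ := h2'.integral_hankelKernel_swap hc hu hμ
    (h2'.mem_slitPlane.mono fun t ht => hf _ (ht R hRm))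
  obtain ⟨i3, j3, e3⟩ := h3.integral_hankelKernel_swap hc hu hμ
    (h3.mem_slitPlane.mono fun t ht => hf _ (ht R hRm))
  refine ⟨hankelIntegrable_iff.2 ⟨i1, i2, i3⟩, ?_⟩
  simp_rw [hankelIntegral_eq h0.le]
  have j12 : Integrable (fun s => (∫ t in Set.Iic b, hankelKernel c u s (t - η * Complex.I))
      + Complex.I * ∫ y in Set.uIoc (-η) η, hankelKernel c u s (b + y * Complex.I)) μ :=
    j1.add (j2.const_mul _)
  rw [e1, e2, e3, integral_sub j12 j3, integral_add j1 (j2.const_mul _),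
    integral_const_mul]

/-- If `μ` and `ν` are carried by `[0, R]` and are linked by the Markov–Krein identity, then the
Mellin transform of `μ` is a Hankel integral involving `ν`. -/
theorem integral_cpow_eq_mellinContour [IsFiniteMeasure ν] (hc : 0 < c) (hu : 0 < u.re)
    (hR : 0 < R) (hμ : ∀ᵐ s ∂μ, s ∈ Set.Icc 0 R) (hν : ∀ᵐ s ∂ν, s ∈ Set.Icc 0 R)
    (hMK : ∀ t : ℝ, 0 ≤ t →
      ∫ s, (1 + t * s) ^ (-c) ∂μ = Real.exp (-c * ∫ s, Real.log (1 + t * s) ∂ν))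
    {b η : ℝ} (hb : Real.log R < b) (h0 : 0 < η) (h2 : η < 2 * Real.pi) :
    HankelIntegrable (mellinIntegrand ν c u) b η ∧
      ∫ s : ℝ, (s : ℂ) ^ u ∂μ = mellinContour ν c u b η := by
  have hf : ∀ z : ℂ, 1 - (R : ℂ) * Complex.exp (-z) ∈ Complex.slitPlane →
      mellinIntegrand ν c u z = ∫ s, hankelKernel c u s z ∂μ := by
    intro z hz
    have := markovKrein_complex hR hμ hν hMK hz
    simp only [mellinIntegrand, hankelKernel, sub_eq_add_neg (u * z), Complex.exp_add]
    rw [integral_const_mul, this]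
  obtain ⟨hi, he⟩ := hankelIntegral_integral_hankelKernel hc.le hu hR hμ hf hb h0 h2
  refine ⟨hi, ?_⟩
  rw [mellinContour, he, ← integral_const_mul, ← integral_const_mul]
  refine integral_congr_ae ?_
  filter_upwards [hμ] with s hs
  exact (hankelIntegral_hankelKernel hc hu hR hs hb h0 h2).symm

end Fubini

/-! ### Random means of Dirichlet processes -/

section RandomMean

theorem clamp_mem_Icc {M : ℝ} (hM : 0 ≤ M) (x : ℝ) : min (max x 0) M ∈ Set.Icc 0 M :=
  ⟨le_min (le_max_right _ _) hM, min_le_right _ _⟩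

theorem truncatedMeasure_eq_map {ρ : Measure ℝ} (hρ : ρ (Set.Iio 0) = 0) {M : ℝ} (hM : 0 < M) :
    truncatedMeasure ρ M = ρ.map fun x => min (max x 0) M := by
  have h0 : ρ (Set.Iic (-M)) = 0 :=
    measure_mono_null (fun x hx => lt_of_le_of_lt (Set.mem_Iic.1 hx) (neg_lt_zero.2 hM)) hρ
  have hsplit : ρ = ρ.restrict (Set.Ioo (-M) M) + ρ.restrict (Set.Ici M) := by
    have hd : Disjoint (Set.Ioo (-M) M) (Set.Ici M) :=
      Set.disjoint_left.2 fun x hx hx' => not_lt.2 (Set.mem_Ici.1 hx') hx.2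
    rw [← Measure.restrict_union hd measurableSet_Ici, Set.Ioo_union_Ici_eq_Ioi (by linarith)]
    symm
    refine Measure.restrict_eq_self_of_ae_mem ?_
    rw [ae_iff]
    simpa [Set.Iic_def] using h0
  have hmeas : Measurable fun x : ℝ => min (max x 0) M := by fun_prop
  have h1 : (ρ.restrict (Set.Ioo (-M) M)).map (fun x => min (max x 0) M)
      = ρ.restrict (Set.Ioo (-M) M) := by
    conv_rhs => rw [← Measure.map_id (μ := ρ.restrict (Set.Ioo (-M) M))]
    refine Measure.map_congr ?_
    have hnn : ∀ᵐ x ∂ρ, 0 ≤ x := by rw [ae_iff]; simpa [Set.Iio_def] using hρ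
    filter_upwards [ae_restrict_of_ae hnn, ae_restrict_mem measurableSet_Ioo] with x hx hx'
    simp [max_eq_left hx, hx'.2.le]
  have h2 : (ρ.restrict (Set.Ici M)).map (fun x => min (max x 0) M)
      = ρ (Set.Ici M) • Measure.dirac M := by
    have : (fun x : ℝ => min (max x 0) M) =ᵐ[ρ.restrict (Set.Ici M)] fun _ => M := by
      filter_upwards [ae_restrict_mem measurableSet_Ici] with x hx
      exact min_eq_right (le_max_of_le_left hx)
    rw [Measure.map_congr this, Measure.map_const, Measure.restrict_apply_univ]
  conv_rhs => rw [hsplit, Measure.map_add _ _ hmeas, h1, h2]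
  rw [truncatedMeasure, h0, zero_smul, zero_add]

theorem map_clamp_eq_self {ρ : Measure ℝ} (hρ : ρ (Set.Iio 0) = 0) {R : ℝ} (hR : ρ (Set.Ioi R) = 0) :
    ρ.map (fun x => min (max x 0) R) = ρ := by
  conv_rhs => rw [← Measure.map_id (μ := ρ)]
  refine Measure.map_congr ?_
  have h1 : ∀ᵐ x ∂ρ, 0 ≤ x := by rw [ae_iff]; simpa [Set.Iio_def] using hρ
  have h2 : ∀ᵐ x ∂ρ, x ≤ R := by rw [ae_iff]; simpa [Set.Ioi_def] using hR
  filter_upwards [h1, h2] with x hx hx'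
  rw [max_eq_left hx, min_eq_left hx', id]

theorem measurable_randomMean {Ω : Type*} [MeasurableSpace Ω] {D : Kernel Ω ℝ} :
    Measurable fun ω => ∫ x, x ∂(D ω) :=
  (StronglyMeasurable.integral_kernel (κ := D) (f := fun x : ℝ => x)
    measurable_id.stronglyMeasurable).measurable

variable {Ω : Type*} [MeasurableSpace Ω] {P : Measure Ω} [IsProbabilityMeasure P]
  {ρ : Measure ℝ} [IsProbabilityMeasure ρ] {c : ℝ} {D : Kernel Ω ℝ} [IsMarkovKernel D] {u : ℂ}

theorem integral_cpow_integral_eq_mellinContour (hc : 0 < c)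
    (hD : IsDirichletProcess P D (ENNReal.ofReal c • ρ)) (hu : 0 < u.re) {f : ℝ → ℝ}
    (hf : Measurable f) {R : ℝ} (hR : 0 < R) (hfR : ∀ x, f x ∈ Set.Icc 0 R)
    {b η : ℝ} (hb : Real.log R < b) (h0 : 0 < η) (h2 : η < 2 * Real.pi) :
    HankelIntegrable (mellinIntegrand (ρ.map f) c u) b η ∧
      ∫ ω, ((∫ x, f x ∂(D ω) : ℝ) : ℂ) ^ u ∂P = mellinContour (ρ.map f) c u b η := by
  have hX := (StronglyMeasurable.integral_kernel (κ := D) hf.stronglyMeasurable).measurable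
  have hXR : ∀ ω, ∫ x, f x ∂(D ω) ∈ Set.Icc 0 R := fun ω =>
    ⟨integral_nonneg fun x => (hfR x).1, by
      simpa using integral_mono (integrable_of_mem_Icc (μ := D ω) hf hfR) (integrable_const R)
        fun x => (hfR x).2⟩
  have key := integral_cpow_eq_mellinContour (μ := P.map fun ω => ∫ x, f x ∂(D ω)) (ν := ρ.map f)
    hc hu hR
    ((ae_map_iff hX.aemeasurable measurableSet_Icc).2 (ae_of_all _ hXR))
    ((ae_map_iff hf.aemeasurable measurableSet_Icc).2 (ae_of_all _ hfR))
    (fun t ht => by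
      rw [integral_map hX.aemeasurable (Measurable.aestronglyMeasurable (by fun_prop)),
        integral_map hf.aemeasurable (Measurable.aestronglyMeasurable (by fun_prop))]
      exact markovKrein_bounded hc hD hf hfR ht) hb h0 h2
  rwa [integral_map hX.aemeasurable (Measurable.aestronglyMeasurable (by fun_prop))] at key

theorem ae_measure_eq_zero (hc : 0 < c) (hD : IsDirichletProcess P D (ENNReal.ofReal c • ρ))
    {s : Set ℝ} (hs : MeasurableSet s) (h : ρ s = 0) : ∀ᵐ ω ∂P, D ω s = 0 := by
  obtain ⟨K, _, hle⟩ := exists_bind_le_smul hc hD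
  have h1 : (D ∘ₘ P) s = 0 := by
    have := hle s
    simpa [h] using this
  rw [Measure.bind_apply hs D.measurable.aemeasurable,
    lintegral_eq_zero_iff (D.measurable_coe hs)] at h1
  exact h1

theorem lintegral_rpow_lintegral_lt_top (hc : 0 < c)
    (hD : IsDirichletProcess P D (ENNReal.ofReal c • ρ)) (hρ : ρ (Set.Iio 0) = 0) {p : ℝ}
    (hp : 0 < p) (hint : Integrable (fun x : ℝ => x ^ p) ρ) :
    ∫⁻ ω, (∫⁻ x, ENNReal.ofReal x ∂(D ω)) ^ p ∂P < ⊤ := by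
  obtain ⟨K, hK, hle⟩ := exists_lintegral_rpow_lintegral_le hc hD hp
  refine hle.trans_lt (ENNReal.mul_lt_top hK.lt_top ?_)
  refine lt_of_eq_of_lt ?_ hint.lintegral_lt_top
  have hnn : ∀ᵐ x ∂ρ, 0 ≤ x := by rw [ae_iff]; simpa [Set.Iio_def] using hρ
  refine lintegral_congr_ae ?_
  filter_upwards [hnn] with x hx
  rw [ENNReal.ofReal_rpow_of_nonneg hx hp.le]

theorem ae_integrable_and_nonneg (hc : 0 < c)
    (hD : IsDirichletProcess P D (ENNReal.ofReal c • ρ)) (hρ : ρ (Set.Iio 0) = 0) {p : ℝ}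
    (hp : 0 < p) (hint : Integrable (fun x : ℝ => x ^ p) ρ) :
    ∀ᵐ ω ∂P, Integrable (fun x : ℝ => x) (D ω) ∧ ∀ᵐ x ∂(D ω), 0 ≤ x := by
  have hm : Measurable fun ω => ∫⁻ x, ENNReal.ofReal x ∂(D ω) :=
    Measurable.lintegral_kernel (by fun_prop)
  filter_upwards [ae_measure_eq_zero hc hD measurableSet_Iio hρ,
    ae_lt_top (by fun_prop) (lintegral_rpow_lintegral_lt_top hc hD hρ hp hint).ne] with ω h1 h2
  have hnn : ∀ᵐ x ∂(D ω), 0 ≤ x := by rw [ae_iff]; simpa [Set.Iio_def] using h1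
  refine ⟨⟨by fun_prop, ?_⟩, hnn⟩
  rw [HasFiniteIntegral]
  refine lt_of_eq_of_lt (lintegral_congr_ae (g := fun x => ENNReal.ofReal x) ?_)
    ((ENNReal.rpow_lt_top_iff_of_pos hp).1 h2)
  filter_upwards [hnn] with x hx
  rw [Real.enorm_of_nonneg hx]

theorem integrable_rpow_randomMean (hc : 0 < c)
    (hD : IsDirichletProcess P D (ENNReal.ofReal c • ρ)) (hρ : ρ (Set.Iio 0) = 0) {p : ℝ}
    (hp : 0 < p) (hint : Integrable (fun x : ℝ => x ^ p) ρ) :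
    Integrable (fun ω => (∫ x, x ∂(D ω)) ^ p) P := by
  have hm := measurable_randomMean (D := D)
  refine ⟨Measurable.aestronglyMeasurable (by fun_prop), ?_⟩
  rw [HasFiniteIntegral]
  refine lt_of_eq_of_lt (lintegral_congr_ae ?_) (lintegral_rpow_lintegral_lt_top hc hD hρ hp hint)
  filter_upwards [ae_integrable_and_nonneg hc hD hρ hp hint] with ω hω
  rw [← ofReal_integral_eq_lintegral_ofReal hω.1 hω.2,
    ENNReal.ofReal_rpow_of_nonneg (integral_nonneg_of_ae hω.2) hp.le,
    Real.enorm_of_nonneg (Real.rpow_nonneg (integral_nonneg_of_ae hω.2) _)]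

theorem norm_ofReal_cpow_le {x y : ℝ} (hu : 0 < u.re) (hx : 0 ≤ x) (hxy : x ≤ y) :
    ‖(x : ℂ) ^ u‖ ≤ y ^ u.re := by
  rw [Complex.norm_cpow_eq_rpow_re_of_nonneg hx hu.ne']
  exact Real.rpow_le_rpow hx hxy hu.le

theorem tendsto_integral_cpow_truncated (hc : 0 < c)
    (hD : IsDirichletProcess P D (ENNReal.ofReal c • ρ)) (hρ : ρ (Set.Iio 0) = 0)
    (hu : 0 < u.re) (hint : Integrable (fun x : ℝ => x ^ u.re) ρ) :
    Tendsto (fun M : ℝ => ∫ ω, ((∫ x, min (max x 0) M ∂(D ω) : ℝ) : ℂ) ^ u ∂P) atTop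
      (𝓝 (∫ ω, ((∫ x, x ∂(D ω) : ℝ) : ℂ) ^ u ∂P)) := by
  have hae := ae_integrable_and_nonneg hc hD hρ hu hint
  refine tendsto_integral_filter_of_dominated_convergence (fun ω => (∫ x, x ∂(D ω)) ^ u.re)
    (Eventually.of_forall fun M => ?_) ?_ (integrable_rpow_randomMean hc hD hρ hu hint) ?_
  · have := (StronglyMeasurable.integral_kernel (κ := D) (f := fun x : ℝ => min (max x 0) M)
      (Measurable.stronglyMeasurable (by fun_prop))).measurable
    exact Measurable.aestronglyMeasurable (by fun_prop)
  · filter_upwards [eventually_ge_atTop 0] with M hM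
    filter_upwards [hae] with ω hω
    refine norm_ofReal_cpow_le hu (integral_nonneg fun x => (clamp_mem_Icc hM x).1) ?_
    refine integral_mono_ae (integrable_of_mem_Icc (by fun_prop) (clamp_mem_Icc hM)) hω.1 ?_
    filter_upwards [hω.2] with x hx
    rw [max_eq_left hx]
    exact min_le_left _ _
  · filter_upwards [hae] with ω hω
    refine ((Complex.continuous_ofReal_cpow_const hu).tendsto _).comp ?_
    refine tendsto_integral_filter_of_dominated_convergence (fun x => |x|)
      (Eventually.of_forall fun M => Measurable.aestronglyMeasurable (by fun_prop)) ?_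
      hω.1.norm ?_
    · filter_upwards [eventually_ge_atTop 0] with M hM
      filter_upwards [hω.2] with x hx
      rw [Real.norm_of_nonneg (clamp_mem_Icc hM x).1, max_eq_left hx, abs_of_nonneg hx]
      exact min_le_left _ _
    · filter_upwards [hω.2] with x hx
      refine tendsto_const_nhds.congr' ?_
      filter_upwards [eventually_ge_atTop x] with M hM
      rw [max_eq_left hx, min_eq_left hM]

theorem ae_integral_clamp_eq (hc : 0 < c)
    (hD : IsDirichletProcess P D (ENNReal.ofReal c • ρ)) (hρ : ρ (Set.Iio 0) = 0) {R : ℝ}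
    (hR : ρ (Set.Ioi R) = 0) :
    ∀ᵐ ω ∂P, ∫ x, min (max x 0) R ∂(D ω) = ∫ x, x ∂(D ω) := by
  filter_upwards [ae_measure_eq_zero hc hD measurableSet_Iio hρ,
    ae_measure_eq_zero hc hD measurableSet_Ioi hR] with ω h1 h2
  have h1' : ∀ᵐ x ∂(D ω), 0 ≤ x := by rw [ae_iff]; simpa [Set.Iio_def] using h1
  have h2' : ∀ᵐ x ∂(D ω), x ≤ R := by rw [ae_iff]; simpa [Set.Ioi_def] using h2
  refine integral_congr_ae ?_
  filter_upwards [h1', h2'] with x hx hx'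
  rw [max_eq_left hx, min_eq_left hx']

end RandomMean

theorem mainTheorem4 {Ω : Type*} [MeasurableSpace Ω] (P : Measure Ω) [IsProbabilityMeasure P]
    (ρ : Measure ℝ) [IsProbabilityMeasure ρ] (hρ : ρ (Set.Iio 0) = 0)
    (c : ℝ) (hc : 0 < c)
    (D : Kernel Ω ℝ) [IsMarkovKernel D] (hD : IsDirichletProcess P D (ENNReal.ofReal c • ρ))
    (u : ℂ) (hu : 0 < u.re) (hint : Integrable (fun x : ℝ => x ^ u.re) ρ) :
    -- the random mean exists almost surely, and the Mellin transform of its law converges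
    (∀ᵐ ω ∂P, Integrable (fun x : ℝ => x) (D ω)) ∧
    Integrable (fun x : ℝ => (x : ℂ) ^ u) (randomMeanLaw P D) ∧
    -- the general case, with truncations; the loop may change with `M`
    (∀ b η : ℝ → ℝ,
      (∀ M : ℝ, 0 < M → Real.log M < b M ∧ 0 < η M ∧ η M < 2 * Real.pi) →
      (∀ M : ℝ, 0 < M → HankelIntegrable (mellinIntegrand (truncatedMeasure ρ M) c u) (b M) (η M)) ∧
      Tendsto (fun M : ℝ => mellinContour (truncatedMeasure ρ M) c u (b M) (η M)) atTop
        (𝓝 (∫ x : ℝ, (x : ℂ) ^ u ∂(randomMeanLaw P D)))) ∧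
    -- the case of compact support, contained in `[0, R]`
    (∀ R : ℝ, 0 < R → ρ (Set.Ioi R) = 0 →
      ∀ b η : ℝ, Real.log R < b → 0 < η → η < 2 * Real.pi →
        HankelIntegrable (mellinIntegrand ρ c u) b η ∧
        ∫ x : ℝ, (x : ℂ) ^ u ∂(randomMeanLaw P D) = mellinContour ρ c u b η) := by
  have hae := ae_integrable_and_nonneg hc hD hρ hu hint
  have hm := measurable_randomMean (D := D)
  have hpow : ∀ μ : Measure ℝ, AEStronglyMeasurable (fun x : ℝ => (x : ℂ) ^ u) μ := fun μ =>
    Measurable.aestronglyMeasurable (by fun_prop)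
  have hlaw : ∫ x : ℝ, (x : ℂ) ^ u ∂(randomMeanLaw P D)
      = ∫ ω, ((∫ x, x ∂(D ω) : ℝ) : ℂ) ^ u ∂P := integral_map hm.aemeasurable (hpow _)
  have hclamp : ∀ M : ℝ, Measurable fun x : ℝ => min (max x 0) M := fun M => by fun_prop
  refine ⟨hae.mono fun ω hω => hω.1, ?_, fun b η hbη => ?_, fun R hR hRρ b η hb h0 h2 => ?_⟩
  · refine (integrable_map_measure (hpow _) hm.aemeasurable).2 ?_
    refine (integrable_rpow_randomMean hc hD hρ hu hint).mono'
      (Measurable.aestronglyMeasurable (by fun_prop)) ?_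
    filter_upwards [hae] with ω hω
    exact norm_ofReal_cpow_le hu (integral_nonneg_of_ae hω.2) le_rfl
  · have key : ∀ M : ℝ, 0 < M → _ := fun M hM =>
      integral_cpow_integral_eq_mellinContour hc hD hu (hclamp M) hM (clamp_mem_Icc hM.le)
        (hbη M hM).1 (hbη M hM).2.1 (hbη M hM).2.2
    refine ⟨fun M hM => truncatedMeasure_eq_map hρ hM ▸ (key M hM).1, ?_⟩
    rw [hlaw]
    refine (tendsto_integral_cpow_truncated hc hD hρ hu hint).congr' ?_
    filter_upwards [eventually_gt_atTop 0] with M hM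
    rw [truncatedMeasure_eq_map hρ hM, (key M hM).2]
  · have key := integral_cpow_integral_eq_mellinContour hc hD hu (hclamp R) hR
      (clamp_mem_Icc hR.le) hb h0 h2
    rw [map_clamp_eq_self hρ hRρ] at key
    refine ⟨key.1, ?_⟩
    rw [hlaw, ← key.2]
    refine integral_congr_ae ?_
    filter_upwards [ae_integral_clamp_eq hc hD hρ hRρ] with ω hω
    rw [hω]
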